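/- Let $k$ be a field of characteristic $0$. All varieties below are varieties over $k$. Let $\mathrm{End}_2\subset\mathbb{P}^5$ be the variety of endomorphisms $[u:v]\mapsto[a_0u^2+a_1uv+a_2v^2:a_3u^2+a_4uv+a_5v^2]$ of degree $2$ of $\mathbb{P}^1$ (the two quadratic forms have no common root), and let $\widetilde{\mathrm M}_2(6)\subset \mathrm{End}_2\times(\mathbb{P}^1)^6$ be the variety of tuples $(f,p_1,\dots,p_6)$ with $p_1,\dots,p_6$ pairwise distinct, $f(p_i)=p_{i+1}$ for $1\le i\le 5$ and $f(p_6)=p_1$. Let $\mathrm M_2(6)=\widetilde{\mathrm M}_2(6)/\mathrm{PGL}_2$ be the geometric quotient for the action $\nu\cdot(f,p_1,\dots,p_6)=(\nu f\nu^{-1},\nu(p_1),\dots,\nu(p_6))$, and let $\sigma_6$ be the automorphism of $\mathrm M_2(6)$ sending the class of $(f,p_1,\dots,p_6)$ to the class of $(f,p_2,\dots,p_6,p_1)$. Every class has a representative with $(p_1,\dots,p_6)=([0:1],[1:0],[1:1],[x:1],[y:1],[z:1])$ for a unique $(x,y,z)\in\mathbb{A}^3$. Let $S_6\subset\mathbb{P}^3$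 be the surface $W^2F_3(X,Y,Z)=F_5(X,Y,Z)$, where $$F_3=(X+Y+Z)^3+(X^2Z+XY^2+YZ^2)+2XYZ,$$ $$F_5=(Z^3X^2+X^3Y^2+Y^3Z^2)-XYZ(YZ+XY+XZ).$$ It is a (geometrically) irreducible quintic. The rational map $\varphi:\mathbb{A}^3\dashrightarrow\mathbb{P}^3$, $$\varphi(x,y,z)=[-y+z-yz+xy:\ -y-z+yz+2x-xy:\ y-z-yz+xy:\ y+z-xy-yz],$$ is birational, with inverse $$\varphi^{-1}([W:X:Y:Z])=\left(\frac{(X+Z)(W+Y)}{W^2+XY+YZ+XZ},\ \frac{W+Y}{X+Y},\ \frac{(W+Z)(W+Y)}{W^2+XY+YZ+XZ}\right);$$ it restricts to an isomorphism from the open set $y(y-1)(x-z)\neq0$ of $\mathbb{A}^3$ to the open set $(W^2+XY+YZ+XZ)(X+Y)(W+Y)(W-X)\ne0$ of $\mathbb{P}^3$. Moreover: (i) The map sending the class of $(f,[0:1],[1:0],[1:1],[x:1],[y:1],[z:1])$ to $\varphi(x,y,z)$ is an isomorphism from $\mathrm M_2(6)$ to an open subset $U$ of $S_6$. Under it, $\sigma_6$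 is the restriction of the automorphism $[W:X:Y:Z]\mapsto[-W:Y:Z:X]$ of $\mathbb{P}^3$. (ii) The complement $S_6\setminus U$ is the union of the $9$ lines $$W=Z=-Y,\quad W=Y=-Z,\quad W=Y=-X,\quad W=X=-Y,\quad W=X=-Z,\quad W=Z=-X,$$ $$-X=Y=Z,\quad X=-Y=Z,\quad X=Y=-Z$$ and of the $14$ irreducible conics $$W=\pm(X+Y+Z),\ X^2+Y^2+Z^2+3(XY+XZ+YZ)=0;$$ $$W=\pm X,\ X^2+XY+3XZ-YZ=0;\qquad W=\pm Y,\ Y^2+YZ+3YX-ZX=0;\qquad W=\pm Z,\ Z^2+ZX+3ZY-XY=0;$$ $$Z=X,\ W(Y+3X)\pm X(X-Y)=0;\qquad Y=Z,\ W(X+3Z)\pm Z(Z-X)=0;\qquad X=Y,\ W(Z+3Y)\pm Y(Y-Z)=0,$$ and these $23$ curves are pairwise distinct. This complement is also the intersection of $S_6$ with the hypersurface of degree $14$ $$(W^2+XY+YZ+XZ)(W^2-X^2)(W^2-Y^2)(W^2-Z^2)(X^2-Y^2)(Y^2-Z^2)(X^2-Z^2)=0,$$ i.e. $U$ consists of the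 points $[W:X:Y:Z]\in S_6$ such that $W^2+XY+YZ+XZ\ne0$ and $W^2,X^2,Y^2,Z^2$ are pairwise distinct. -/

import Mathlib

open scoped LinearAlgebra.Projectivization MatrixGroups Topology

noncomputable section

namespace M26

universe u v w

/-! ### Varieties as spaces with functions

Varieties over a field `k` of characteristic zero are described classically, by their points over
an algebraically closed extension `K` of `k`, together with the Zariski `k`-topology and the
`K`-valued functions that are regular over `k`. -/

/-- A set with a topology and, for every open set `U`, a notion of regular function on `U`.
Functions are total; only their values on `U` matter. -/
structure FunSpace (K : Type u) (X : Type v) where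
  top : TopologicalSpace X
  regular : Set X → (X → K) → Prop

namespace FunSpace

variable {K : Type u} {X : Type v} {Y : Type w}

/-- The structure induced along an (injective) map `i : X → Y`: the topology is the induced one, and
the regular functions are locally the restrictions of regular functions on `Y`. -/
def induced (B : FunSpace K Y) (i : X → Y) : FunSpace K X where
  top := TopologicalSpace.induced i B.top
  regular U f := ∀ x ∈ U, ∃ V : Set Y, IsOpen[B.top] V ∧ i x ∈ V ∧
    ∃ g : Y → K, B.regular V g ∧ ∀ y ∈ U, i y ∈ V → f y = g (i y)

/-- The quotient structure along a (surjective) map `π : X → Y`: a set is open iff its preimage is,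
and a function is regular iff its pull-back is. For the quotient by a group this says that
the regular functions on the quotient are the invariant regular functions. -/
def quotient (A : FunSpace K X) (π : X → Y) : FunSpace K Y where
  top := TopologicalSpace.coinduced π A.top
  regular U f := A.regular (π ⁻¹' U) (f ∘ π)

/-- The bijection `e` is an isomorphism: it identifies the open sets and the regular functions. -/
def IsIso (A : FunSpace K X) (B : FunSpace K Y) (e : X ≃ Y) : Prop :=
  (∀ U : Set Y, IsOpen[A.top] (e ⁻¹' U) ↔ IsOpen[B.top] U) ∧
  ∀ U : Set Y, IsOpen[B.top] U → ∀ f : Y → K, A.regular (e ⁻¹' U) (f ∘ e) ↔ B.regular U f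

end FunSpace

section Spaces

variable (k : Type u) (K : Type v) [Field k] [Field K] [Algebra k K]

/-- Affine space with coordinates indexed by `σ`, with its Zariski `k`-topology; the regular
functions are locally quotients of polynomials with coefficients in `k`. -/
def affineSpace (σ : Type w) : FunSpace K (σ → K) where
  top := TopologicalSpace.generateFrom
    {U | ∃ q : MvPolynomial σ k, U = {x | MvPolynomial.aeval x q ≠ 0}}
  regular U f := ∀ x ∈ U, ∃ p q : MvPolynomial σ k, MvPolynomial.aeval x q ≠ 0 ∧
    ∀ y ∈ U, MvPolynomial.aeval y q ≠ 0 →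
      f y = MvPolynomial.aeval y p / MvPolynomial.aeval y q

/-- Projective space of dimension `n - 1`, as the quotient of the nonzero vectors of affine
`n`-space by scaling. -/
def projSpace (n : ℕ) : FunSpace K (ℙ K (Fin n → K)) :=
  ((affineSpace k K (Fin n)).induced
    (Subtype.val : {v : Fin n → K // v ≠ 0} → (Fin n → K))).quotient (Projectivization.mk' K)

/-- The product `ℙ⁵ × (ℙ¹)⁶`, as the quotient of the product of the spaces of nonzero vectors
by separate scalings. -/
def ambientSpace : FunSpace K (ℙ K (Fin 6 → K) × (Fin 6 → ℙ K (Fin 2 → K))) :=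
  ((affineSpace k K (Fin 6 ⊕ (Fin 6 × Fin 2))).induced
    (fun c : {a : Fin 6 → K // a ≠ 0} × (Fin 6 → {v : Fin 2 → K // v ≠ 0}) =>
      Sum.elim c.1.1 (fun ij => (c.2 ij.1).1 ij.2))).quotient
    (fun c => (Projectivization.mk' K c.1, fun i => Projectivization.mk' K (c.2 i)))

end Spaces

section Moduli

variable (K : Type v) [Field K]

/-- The map `(u, v) ↦ (a₀u² + a₁uv + a₂v², a₃u² + a₄uv + a₅v²)`. -/
def quadMap {K : Type v} [Field K] (a : Fin 6 → K) (x : Fin 2 → K) : Fin 2 → K :=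
  ![a 0 * x 0 ^ 2 + a 1 * x 0 * x 1 + a 2 * x 1 ^ 2,
    a 3 * x 0 ^ 2 + a 4 * x 0 * x 1 + a 5 * x 1 ^ 2]

/-- Endomorphisms of degree `2` of `ℙ¹` (over algebraically closed `K`): the points
`[a₀ : … : a₅]` of `ℙ⁵` for which the two quadratic forms have no common root. -/
def End2 : Set (ℙ K (Fin 6 → K)) :=
  {a | ∀ x : Fin 2 → K, x ≠ 0 → quadMap a.rep x ≠ 0}

/-- The action of an endomorphism of degree `2` on points. -/
def End2.app {K : Type v} [Field K] (f : End2 K) (x : ℙ K (Fin 2 → K)) : ℙ K (Fin 2 → K) :=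
  Projectivization.mk K (quadMap f.1.rep x.rep) (f.2 _ x.rep_nonzero)

/-- Endomorphisms `f` of degree `2` with a cycle `p₁ ↦ p₂ ↦ … ↦ p₆ ↦ p₁` of `6` distinct points,
as a subvariety of `ℙ⁵ × (ℙ¹)⁶`. The points are indexed by `Fin 6`, with cyclic addition. -/
def MTilde : Set (ℙ K (Fin 6 → K) × (Fin 6 → ℙ K (Fin 2 → K))) :=
  {m | Function.Injective m.2 ∧
    ∃ h : m.1 ∈ End2 K, ∀ i : Fin 6, End2.app ⟨m.1, h⟩ (m.2 i) = m.2 (i + 1)}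

variable {K}

/-- The endomorphism of a point of `MTilde K`. -/
def endo (m : MTilde K) : End2 K := ⟨m.1.1, m.2.2.1⟩

/-- The orbit relation of the action `ν · (f, pᵢ) = (ν f ν⁻¹, ν pᵢ)` of `PGL₂`. -/
def orbitSetoid (K : Type v) [Field K] : Setoid (MTilde K) where
  r m n := ∃ ν : PGL(Fin 2, K),
    (∀ x, End2.app (endo n) (ν • x) = ν • End2.app (endo m) x) ∧ ∀ i, n.1.2 i = ν • m.1.2 i
  iseqv :=
    { refl := fun m => ⟨1, fun x => by simp, fun i => by simp⟩
      symm := by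
        rintro m n ⟨ν, h, h'⟩
        refine ⟨ν⁻¹, fun x => ?_, fun i => ?_⟩
        · have := h (ν⁻¹ • x)
          rw [smul_inv_smul] at this
          rw [this, inv_smul_smul]
        · rw [h', inv_smul_smul]
      trans := by
        rintro m n l ⟨ν, h, h'⟩ ⟨μ, g, g'⟩
        exact ⟨μ * ν, fun x => by rw [mul_smul, g, h, mul_smul],
          fun i => by rw [g', h', mul_smul]⟩ }

variable (K) in
/-- The points of the moduli space: orbits of `PGL₂` on `MTilde K`. -/
def Moduli : Type v := Quotient (orbitSetoid K)

/-- The class of a point of `MTilde K`. -/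
def Moduli.mk (m : MTilde K) : Moduli K := Quotient.mk (orbitSetoid K) m

/-- The moduli space as the quotient variety of `MTilde K` by `PGL₂`. -/
def moduliSpace (k : Type u) (K : Type v) [Field k] [Field K] [Algebra k K] :
    FunSpace K (Moduli K) :=
  ((ambientSpace k K).induced (Subtype.val : MTilde K → _)).quotient Moduli.mk

/-- `(f, p₁, …, p₆) ↦ (f, p₂, …, p₆, p₁)`. -/
def rotate (m : MTilde K) : MTilde K :=
  ⟨(m.1.1, fun i => m.1.2 (i + 1)),
    fun i j h => by simpa using m.2.1 h, m.2.2.1, fun i => m.2.2.2 (i + 1)⟩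

/-- The automorphism of the moduli space given by rotation of the cycle. -/
def sigma6 : Moduli K → Moduli K :=
  Quotient.map' (s₁ := orbitSetoid K) (s₂ := orbitSetoid K) rotate (by
    rintro m n ⟨ν, h, h'⟩
    exact ⟨ν, h, fun i => h' (i + 1)⟩)

/-- The points `[0:1], [1:0], [1:1], [x:1], [y:1], [z:1]` of `ℙ¹`, where `t = (x, y, z)`. -/
def normalCycle (t : Fin 3 → K) (i : Fin 6) : ℙ K (Fin 2 → K) :=
  Projectivization.mk K
    ((![![0, 1], ![1, 0], ![1, 1], ![t 0, 1], ![t 1, 1], ![t 2, 1]] : Fin 6 → Fin 2 → K) i)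
    (by
      intro h
      have h0 := congrFun h 0
      have h1 := congrFun h 1
      fin_cases i <;> simp at h0 h1)

end Moduli

/-! ### The quintic surface; homogeneous coordinates are `0 = W, 1 = X, 2 = Y, 3 = Z`. -/

section Surface

open MvPolynomial

/-- `F₃ = (X+Y+Z)³ + (X²Z + XY² + YZ²) + 2XYZ`. -/
def F3 (R : Type v) [CommRing R] : MvPolynomial (Fin 4) R :=
  (X 1 + X 2 + X 3) ^ 3 + (X 1 ^ 2 * X 3 + X 1 * X 2 ^ 2 + X 2 * X 3 ^ 2) + 2 * X 1 * X 2 * X 3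

/-- `F₅ = (Z³X² + X³Y² + Y³Z²) - XYZ(YZ + XY + XZ)`. -/
def F5 (R : Type v) [CommRing R] : MvPolynomial (Fin 4) R :=
  (X 3 ^ 3 * X 1 ^ 2 + X 1 ^ 3 * X 2 ^ 2 + X 2 ^ 3 * X 3 ^ 2) -
    X 1 * X 2 * X 3 * (X 2 * X 3 + X 1 * X 2 + X 1 * X 3)

/-- `W²F₃ - F₅`. -/
def quintic (R : Type v) [CommRing R] : MvPolynomial (Fin 4) R :=
  X 0 ^ 2 * F3 R - F5 R

/-- `(W²+XY+YZ+XZ)(W²-X²)(W²-Y²)(W²-Z²)(X²-Y²)(Y²-Z²)(X²-Z²)`. -/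
def boundaryPoly (R : Type v) [CommRing R] : MvPolynomial (Fin 4) R :=
  (X 0 ^ 2 + X 1 * X 2 + X 2 * X 3 + X 1 * X 3) *
    (X 0 ^ 2 - X 1 ^ 2) * (X 0 ^ 2 - X 2 ^ 2) * (X 0 ^ 2 - X 3 ^ 2) *
    (X 1 ^ 2 - X 2 ^ 2) * (X 2 ^ 2 - X 3 ^ 2) * (X 1 ^ 2 - X 3 ^ 2)

variable {K : Type v} [Field K]

/-- The zero locus in projective space of a homogeneous polynomial. -/
def projZeros {n : ℕ} (q : MvPolynomial (Fin n) K) : Set (ℙ K (Fin n → K)) :=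
  {p | eval p.rep q = 0}

variable (K) in
/-- The quintic surface `W²F₃ = F₅` in `ℙ³`. -/
def S6 : Set (ℙ K (Fin 4 → K)) := projZeros (quintic K)

variable (K) in
/-- The pairs of linear forms cutting out the nine lines. -/
def lineEq : Fin 9 → MvPolynomial (Fin 4) K × MvPolynomial (Fin 4) K :=
  ![(X 0 - X 3, X 0 + X 2),
    (X 0 - X 2, X 0 + X 3),
    (X 0 - X 2, X 0 + X 1),
    (X 0 - X 1, X 0 + X 2),
    (X 0 - X 1, X 0 + X 3),
    (X 0 - X 3, X 0 + X 1),
    (X 2 - X 3, X 2 + X 1),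
    (X 1 - X 3, X 1 + X 2),
    (X 1 - X 2, X 1 + X 3)]

variable (K) in
/-- The linear and the quadratic forms cutting out the fourteen conics. -/
def conicEq : Fin 14 → MvPolynomial (Fin 4) K × MvPolynomial (Fin 4) K :=
  ![(X 0 - (X 1 + X 2 + X 3),
      X 1 ^ 2 + X 2 ^ 2 + X 3 ^ 2 + 3 * (X 1 * X 2 + X 1 * X 3 + X 2 * X 3)),
    (X 0 + (X 1 + X 2 + X 3),
      X 1 ^ 2 + X 2 ^ 2 + X 3 ^ 2 + 3 * (X 1 * X 2 + X 1 * X 3 + X 2 * X 3)),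
    (X 0 - X 1, X 1 ^ 2 + X 1 * X 2 + 3 * X 1 * X 3 - X 2 * X 3),
    (X 0 + X 1, X 1 ^ 2 + X 1 * X 2 + 3 * X 1 * X 3 - X 2 * X 3),
    (X 0 - X 2, X 2 ^ 2 + X 2 * X 3 + 3 * X 2 * X 1 - X 3 * X 1),
    (X 0 + X 2, X 2 ^ 2 + X 2 * X 3 + 3 * X 2 * X 1 - X 3 * X 1),
    (X 0 - X 3, X 3 ^ 2 + X 3 * X 1 + 3 * X 3 * X 2 - X 1 * X 2),
    (X 0 + X 3, X 3 ^ 2 + X 3 * X 1 + 3 * X 3 * X 2 - X 1 * X 2),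
    (X 3 - X 1, X 0 * (X 2 + 3 * X 1) + X 1 * (X 1 - X 2)),
    (X 3 - X 1, X 0 * (X 2 + 3 * X 1) - X 1 * (X 1 - X 2)),
    (X 2 - X 3, X 0 * (X 1 + 3 * X 3) + X 3 * (X 3 - X 1)),
    (X 2 - X 3, X 0 * (X 1 + 3 * X 3) - X 3 * (X 3 - X 1)),
    (X 1 - X 2, X 0 * (X 3 + 3 * X 2) + X 2 * (X 2 - X 3)),
    (X 1 - X 2, X 0 * (X 3 + 3 * X 2) - X 2 * (X 2 - X 3))]

variable (K) in
/-- The lines `L₁, …, L₉`. -/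
def lineCurve (i : Fin 9) : Set (ℙ K (Fin 4 → K)) :=
  projZeros (lineEq K i).1 ∩ projZeros (lineEq K i).2

variable (K) in
/-- The conics `C₁, …, C₁₄`. -/
def conicCurve (i : Fin 14) : Set (ℙ K (Fin 4 → K)) :=
  projZeros (conicEq K i).1 ∩ projZeros (conicEq K i).2

/-- A line in `ℙ³`: the image of `ℙ¹` under an injective linear map. -/
def IsLine (L : Set (ℙ K (Fin 4 → K))) : Prop :=
  ∃ (l : (Fin 2 → K) →ₗ[K] (Fin 4 → K)) (hl : Function.Injective l),
    L = Set.range (Projectivization.map l hl)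

/-- A conic in `ℙ³`: the image of an irreducible plane conic under a linear embedding of `ℙ²`. -/
def IsConic (C : Set (ℙ K (Fin 4 → K))) : Prop :=
  ∃ (l : (Fin 3 → K) →ₗ[K] (Fin 4 → K)) (hl : Function.Injective l)
    (q : MvPolynomial (Fin 3) K), q.IsHomogeneous 2 ∧ Irreducible q ∧
    C = Projectivization.map l hl '' projZeros q

/-- The linear map `(W, X, Y, Z) ↦ (-W, Y, Z, X)`. -/
def tauLin : (Fin 4 → K) →ₗ[K] (Fin 4 → K) where
  toFun v := ![-v 0, v 2, v 3, v 1]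
  map_add' v w := by ext i; fin_cases i <;> simp [add_comm]
  map_smul' c v := by ext i; fin_cases i <;> simp

theorem tauLin_injective : Function.Injective (tauLin (K := K)) := by
  intro v w h
  have h0 := congrFun h 0
  have h1 := congrFun h 1
  have h2 := congrFun h 2
  have h3 := congrFun h 3
  simp [tauLin] at h0 h1 h2 h3
  ext i
  fin_cases i <;> simp [*]

/-- The automorphism `[W : X : Y : Z] ↦ [-W : Y : Z : X]` of `ℙ³`. -/
def tau : ℙ K (Fin 4 → K) → ℙ K (Fin 4 → K) := Projectivization.map tauLin tauLin_injective

/-- Homogeneous coordinates of the rational map `φ : 𝔸³ ⇢ ℙ³`, with `t = (x, y, z)`. -/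
def phi (t : Fin 3 → K) : Fin 4 → K :=
  ![-t 1 + t 2 - t 1 * t 2 + t 0 * t 1,
    -t 1 - t 2 + t 1 * t 2 + 2 * t 0 - t 0 * t 1,
    t 1 - t 2 - t 1 * t 2 + t 0 * t 1,
    t 1 + t 2 - t 0 * t 1 - t 1 * t 2]

/-- The quadratic form `W² + XY + YZ + XZ`. -/
def quadForm (v : Fin 4 → K) : K := v 0 ^ 2 + v 1 * v 2 + v 2 * v 3 + v 1 * v 3

/-- The inverse rational map `ψ : ℙ³ ⇢ 𝔸³`, in homogeneous coordinates `v = (W, X, Y, Z)`. -/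
def psi (v : Fin 4 → K) : Fin 3 → K :=
  ![(v 1 + v 3) * (v 0 + v 2) / quadForm v,
    (v 0 + v 2) / (v 1 + v 2),
    (v 0 + v 3) * (v 0 + v 2) / quadForm v]

variable (K) in
/-- The open subset of `𝔸³` where `y(y-1)(x-z) ≠ 0`. -/
def affineDomain : Set (Fin 3 → K) := {t | t 1 * (t 1 - 1) * (t 0 - t 2) ≠ 0}

variable (K) in
/-- The open subset of `ℙ³` where `(W²+XY+YZ+XZ)(X+Y)(W+Y)(W-X) ≠ 0`. -/
def projDomain : Set (ℙ K (Fin 4 → K)) :=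
  {p | quadForm p.rep * (p.rep 1 + p.rep 2) * (p.rep 0 + p.rep 2) * (p.rep 0 - p.rep 1) ≠ 0}

end Surface

end M26

end

open M26

noncomputable section

/-! Put the cycle in the form `0 ↦ ∞ ↦ 1 ↦ x ↦ y ↦ z ↦ 0`. The arrows out of `0`, `∞` and `z` force
`f(u) = (u - z)(u + c) / (u(u + d))`. The other three arrows are linear equations in `c` and `d`.
Three equations in two unknowns are compatible only if a determinant, `cycleRel`, vanishes; then
Cramer's rule gives `c` and `d` as rational functions of `x, y, z`. The map `f` has degree two as
long as `c ≠ 0`, `d ≠ -z` and `c ≠ d`. For distinct points on `cycleRel = 0` this amounts to `X, Y,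
Z` being distinct, where `φ(x, y, z) = [W : X : Y : Z]` (`normal_of_cycle` and
`quadMap_endoCoef_ne_zero`). Cross-ratios are invariant under `PGL₂` and recover `x, y, z`, so
`Moduli.exists_eq_mk_normalPoint` identifies the moduli space with an explicit locally closed subset
of affine space.

The map `φ` turns these conditions into symmetric ones. The quintic pulls back to a nonvanishing
factor times `cycleRel` (`quinticVal_phi`). The differences of the squares of the coordinates pull
back to products of exactly the quantities required to be nonzero (`isGeneric_phi_iff`). As `φ` is
invertible where `y(y - 1)(x - z) ≠ 0`, the moduli space becomes the open part of the quintic given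
by `IsGeneric`. Both directions are morphisms: cross-ratios are regular on an open set containing
the cycles, and the normal form is a regular section of the quotient map.

The boundary is found by factoring the quintic on each component of the boundary hypersurface
(`exists_curve_of_not_isGeneric`). Irreducibility is Eisenstein's criterion for `F₃W² - F₅`, a
polynomial in `W`, at a point where `F₅` vanishes to first order and `F₃` does not vanish. -/

namespace M26

/-! ### Morphisms of spaces with functions, and their universal properties -/

namespace FunSpace

variable {K : Type*} {X Y Z : Type*}

/-- The regular functions form a sheaf of `k`-algebras, a regular function is invertible where it
does not vanish, and it does not vanish on an open set. -/
structure IsGood [Field K] (k : Type*) [Field k] [Algebra k K] (A : FunSpace K X) : Prop where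
  congr : ∀ {U : Set X} {f g : X → K}, (∀ x ∈ U, f x = g x) → A.regular U f → A.regular U g
  mono : ∀ {U V : Set X} {f : X → K}, V ⊆ U → A.regular U f → A.regular V f
  locality : ∀ {U : Set X} {f : X → K},
    (∀ x ∈ U, ∃ V, IsOpen[A.top] V ∧ x ∈ V ∧ A.regular (U ∩ V) f) → A.regular U f
  const : ∀ (U : Set X) (c : k), A.regular U fun _ => algebraMap k K c
  add : ∀ {U : Set X} {f g : X → K}, A.regular U f → A.regular U g →
    A.regular U fun x => f x + g x
  mul : ∀ {U : Set X} {f g : X → K}, A.regular U f → A.regular U g →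
    A.regular U fun x => f x * g x
  inv : ∀ {U : Set X} {f : X → K}, A.regular U f → (∀ x ∈ U, f x ≠ 0) →
    A.regular U fun x => (f x)⁻¹
  isOpen_ne : ∀ {U : Set X} {f : X → K}, IsOpen[A.top] U → A.regular U f →
    IsOpen[A.top] {x | x ∈ U ∧ f x ≠ 0}

/-- A morphism of spaces with functions. -/
structure Hom (A : FunSpace K X) (B : FunSpace K Y) (f : X → Y) : Prop where
  isOpen_preimage : ∀ U, IsOpen[B.top] U → IsOpen[A.top] (f ⁻¹' U)
  regular_comp : ∀ U, IsOpen[B.top] U → ∀ g, B.regular U g → A.regular (f ⁻¹' U) (g ∘ f)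

theorem Hom.comp {A : FunSpace K X} {B : FunSpace K Y} {C : FunSpace K Z} {f : X → Y} {g : Y → Z}
    (hg : Hom B C g) (hf : Hom A B f) : Hom A C (g ∘ f) where
  isOpen_preimage U hU := hf.isOpen_preimage _ (hg.isOpen_preimage U hU)
  regular_comp U hU h hh :=
    hf.regular_comp _ (hg.isOpen_preimage U hU) _ (hg.regular_comp U hU h hh)

theorem isIso_of_hom {A : FunSpace K X} {B : FunSpace K Y} {e : X ≃ Y} (h : Hom A B e)
    (h' : Hom B A e.symm) : IsIso A B e := by
  have key : ∀ U : Set Y, e.symm ⁻¹' (e ⁻¹' U) = U := fun U => by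
    ext; simp
  refine ⟨fun U => ⟨fun hU => ?_, h.isOpen_preimage U⟩, fun U hU f => ⟨fun hf => ?_,
    h.regular_comp U hU f⟩⟩
  · simpa only [key] using h'.isOpen_preimage _ hU
  · have := h'.regular_comp _ (h.isOpen_preimage U hU) _ hf
    rw [key] at this
    convert this using 1
    ext x
    simp

theorem hom_induced (B : FunSpace K Y) (i : X → Y) : Hom (B.induced i) B i where
  isOpen_preimage U hU := ⟨U, hU, rfl⟩
  regular_comp U hU g hg _ hx := ⟨U, hU, hx, g, hg, fun _ _ _ => rfl⟩

theorem hom_quotient (A : FunSpace K X) (π : X → Y) : Hom A (A.quotient π) π where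
  isOpen_preimage _ hU := hU
  regular_comp _ _ _ hg := hg

theorem Hom.of_comp_quotient {A : FunSpace K X} {B : FunSpace K Z} {π : X → Y} {f : Y → Z}
    (h : Hom A B (f ∘ π)) : Hom (A.quotient π) B f where
  isOpen_preimage := h.isOpen_preimage
  regular_comp := h.regular_comp

theorem isOpen_of_forall {A : FunSpace K X} {U : Set X}
    (h : ∀ x ∈ U, ∃ V, IsOpen[A.top] V ∧ x ∈ V ∧ V ⊆ U) : IsOpen[A.top] U := by
  let := A.top
  refine isOpen_iff_forall_mem_open.2 fun x hx => ?_
  obtain ⟨V, hV, hxV, hVU⟩ := h x hx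
  exact ⟨V, hVU, hV, hxV⟩

theorem isOpen_inter {A : FunSpace K X} {U V : Set X} (hU : IsOpen[A.top] U)
    (hV : IsOpen[A.top] V) : IsOpen[A.top] (U ∩ V) :=
  @IsOpen.inter _ A.top _ _ hU hV

theorem isOpen_univ (A : FunSpace K X) : IsOpen[A.top] Set.univ := @_root_.isOpen_univ _ A.top

theorem Hom.regular {A : FunSpace K X} {B : FunSpace K Y} {f : X → Y} (hf : Hom A B f) {g : Y → K}
    (hg : B.regular Set.univ g) : A.regular Set.univ fun x => g (f x) :=
  hf.regular_comp _ (isOpen_univ B) g hg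

section

variable [Field K] {k : Type*} [Field k] [Algebra k K]

theorem IsGood.regular_zero {A : FunSpace K X} (hA : IsGood k A) (U : Set X) :
    A.regular U fun _ => 0 := by
  simpa using hA.const U 0

theorem IsGood.regular_one {A : FunSpace K X} (hA : IsGood k A) (U : Set X) :
    A.regular U fun _ => 1 := by
  simpa using hA.const U 1

theorem IsGood.neg {A : FunSpace K X} (hA : IsGood k A) {U : Set X} {f : X → K}
    (hf : A.regular U f) : A.regular U fun x => - f x := by
  simpa using hA.mul (hA.const U (-1)) hf

theorem IsGood.sub {A : FunSpace K X} (hA : IsGood k A) {U : Set X} {f g : X → K}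
    (hf : A.regular U f) (hg : A.regular U g) : A.regular U fun x => f x - g x := by
  simpa [sub_eq_add_neg] using hA.add hf (hA.neg hg)

theorem IsGood.div {A : FunSpace K X} (hA : IsGood k A) {U : Set X} {f g : X → K}
    (hf : A.regular U f) (hg : A.regular U g) (h : ∀ x ∈ U, g x ≠ 0) :
    A.regular U fun x => f x / g x := by
  simpa [div_eq_mul_inv] using hA.mul hf (hA.inv hg h)

theorem IsGood.pow {A : FunSpace K X} (hA : IsGood k A) {U : Set X} {f : X → K}
    (hf : A.regular U f) (n : ℕ) : A.regular U fun x => f x ^ n := by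
  induction n with
  | zero => simpa using hA.regular_one U
  | succ n ih => simpa [pow_succ] using hA.mul ih hf

theorem IsGood.induced {B : FunSpace K Y} (hB : IsGood k B) (i : X → Y) :
    IsGood k (B.induced i) where
  congr := by
    intro U f g hfg hf x hx
    obtain ⟨V, hV, hxV, h, hh, e⟩ := hf x hx
    exact ⟨V, hV, hxV, h, hh, fun y hy hyV => by rw [← hfg y hy, e y hy hyV]⟩
  mono := by
    intro U V f hUV hf x hx
    obtain ⟨V, hV, hxV, h, hh, e⟩ := hf x (hUV hx)
    exact ⟨V, hV, hxV, h, hh, fun y hy hyV => e y (hUV hy) hyV⟩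
  locality := by
    intro U f H x hx
    obtain ⟨_, ⟨V, hV, rfl⟩, hxV, hf⟩ := H x hx
    obtain ⟨V', hV', hxV', h, hh, e⟩ := hf x ⟨hx, hxV⟩
    exact ⟨V' ∩ V, isOpen_inter hV' hV, ⟨hxV', hxV⟩, h, hB.mono Set.inter_subset_left hh,
      fun y hy hyV => e y ⟨hy, hyV.2⟩ hyV.1⟩
  const _ c _ _ := ⟨Set.univ, isOpen_univ B, trivial, _, hB.const _ c, fun _ _ _ => rfl⟩
  add := by
    intro U f g hf hg x hx
    obtain ⟨V, hV, hxV, h, hh, e⟩ := hf x hx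
    obtain ⟨V', hV', hxV', h', hh', e'⟩ := hg x hx
    exact ⟨V ∩ V', isOpen_inter hV hV', ⟨hxV, hxV'⟩, _, hB.add
      (hB.mono Set.inter_subset_left hh) (hB.mono Set.inter_subset_right hh'),
      fun y hy hyV => by beta_reduce; rw [e y hy hyV.1, e' y hy hyV.2]⟩
  mul := by
    intro U f g hf hg x hx
    obtain ⟨V, hV, hxV, h, hh, e⟩ := hf x hx
    obtain ⟨V', hV', hxV', h', hh', e'⟩ := hg x hx
    exact ⟨V ∩ V', isOpen_inter hV hV', ⟨hxV, hxV'⟩, _, hB.mul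
      (hB.mono Set.inter_subset_left hh) (hB.mono Set.inter_subset_right hh'),
      fun y hy hyV => by beta_reduce; rw [e y hy hyV.1, e' y hy hyV.2]⟩
  inv := by
    intro U f hf hf0 x hx
    obtain ⟨V, hV, hxV, h, hh, e⟩ := hf x hx
    -- The local extension `h` of `f` may vanish away from the image of `U`, so `V` is shrunk to the
    -- locus where it is invertible.
    refine ⟨{y | y ∈ V ∧ h y ≠ 0}, hB.isOpen_ne hV hh, ⟨hxV, ?_⟩, _,
      hB.inv (hB.mono (fun y hy => hy.1) hh) fun y hy => hy.2,
      fun y hy hyV => by beta_reduce; rw [e y hy hyV.1]⟩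
    rw [← e x hx hxV]
    exact hf0 x hx
  isOpen_ne := by
    rintro _ f ⟨U, hU, rfl⟩ hf
    refine isOpen_of_forall fun x ⟨hx, hfx⟩ => ?_
    obtain ⟨V, hV, hxV, h, hh, e⟩ := hf x hx
    refine ⟨_, ⟨U ∩ {y | y ∈ V ∧ h y ≠ 0}, isOpen_inter hU (hB.isOpen_ne hV hh), rfl⟩,
      ⟨hx, hxV, by rwa [← e x hx hxV]⟩, fun y hy => ⟨hy.1, ?_⟩⟩
    rw [e y hy.1 hy.2.1]
    exact hy.2.2

theorem IsGood.quotient {A : FunSpace K X} (hA : IsGood k A) (π : X → Y) :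
    IsGood k (A.quotient π) where
  congr h hf := hA.congr (fun x hx => h (π x) hx) hf
  mono h hf := hA.mono (Set.preimage_mono h) hf
  locality h := hA.locality fun x hx =>
    let ⟨V, hV, hxV, hf⟩ := h (π x) hx
    ⟨π ⁻¹' V, hV, hxV, hf⟩
  const _ c := hA.const _ c
  add hf hg := hA.add hf hg
  mul hf hg := hA.mul hf hg
  inv hf h := hA.inv hf fun x hx => h (π x) hx
  isOpen_ne hU hf := hA.isOpen_ne hU hf

/-- The principal open sets are closed under finite intersection (multiply the polynomials), so they
form a base and not only a subbase. -/
theorem exists_aeval_ne_zero {σ : Type*} {V : Set (σ → K)}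
    (hV : IsOpen[(affineSpace k K σ).top] V) {x : σ → K} (hx : x ∈ V) :
    ∃ q : MvPolynomial σ k, MvPolynomial.aeval x q ≠ 0 ∧
      ∀ y, MvPolynomial.aeval y q ≠ 0 → y ∈ V := by
  induction hV with
  | basic V hV =>
    obtain ⟨q, rfl⟩ := hV
    exact ⟨q, hx, fun y hy => hy⟩
  | univ => exact ⟨1, by simp, fun _ _ => trivial⟩
  | inter V W _ _ hV hW =>
    obtain ⟨q, hq, hq'⟩ := hV hx.1
    obtain ⟨r, hr, hr'⟩ := hW hx.2
    refine ⟨q * r, by simp [hq, hr], fun y hy => ?_⟩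
    simp only [map_mul, ne_eq, mul_eq_zero, not_or] at hy
    exact ⟨hq' y hy.1, hr' y hy.2⟩
  | sUnion S _ h =>
    obtain ⟨V, hVS, hxV⟩ := hx
    obtain ⟨q, hq, hq'⟩ := h V hVS hxV
    exact ⟨q, hq, fun y hy => ⟨V, hVS, hq' y hy⟩⟩

theorem isOpen_aeval_ne_zero {σ : Type*} (q : MvPolynomial σ k) :
    IsOpen[(affineSpace k K σ).top] {x | MvPolynomial.aeval x q ≠ 0} :=
  TopologicalSpace.GenerateOpen.basic _ ⟨q, rfl⟩

theorem isGood_affineSpace (k K : Type*) [Field k] [Field K] [Algebra k K] (σ : Type*) :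
    IsGood k (affineSpace k K σ) where
  congr := by
    intro U f g hfg hf x hx
    obtain ⟨p, q, hq, e⟩ := hf x hx
    exact ⟨p, q, hq, fun y hy hyV => by rw [← hfg y hy, e y hy hyV]⟩
  mono := by
    intro U V f hUV hf x hx
    obtain ⟨p, q, hq, e⟩ := hf x (hUV hx)
    exact ⟨p, q, hq, fun y hy => e y (hUV hy)⟩
  locality := by
    intro U f H x hx
    obtain ⟨V, hV, hxV, hf⟩ := H x hx
    obtain ⟨p, q, hq, e⟩ := hf x ⟨hx, hxV⟩
    obtain ⟨r, hr, hr'⟩ := exists_aeval_ne_zero hV hxV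
    -- A regular function on affine space is localized only through its denominator. The extra
    -- factor `r` confines the formula to `V`.
    refine ⟨p * r, q * r, by simp [hq, hr], fun y hy hyq => ?_⟩
    simp only [map_mul, ne_eq, mul_eq_zero, not_or] at hyq
    rw [e y ⟨hy, hr' y hyq.2⟩ hyq.1, map_mul, map_mul, mul_div_mul_right _ _ hyq.2]
  const _ c _ _ := ⟨MvPolynomial.C c, 1, by simp, by simp⟩
  add := by
    intro U f g hf hg x hx
    obtain ⟨p, q, hq, e⟩ := hf x hx
    obtain ⟨r, s, hs, e'⟩ := hg x hx
    refine ⟨p * s + q * r, q * s, by simp [hq, hs], fun y hy hyq => ?_⟩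
    simp only [map_mul, ne_eq, mul_eq_zero, not_or] at hyq
    beta_reduce
    rw [e y hy hyq.1, e' y hy hyq.2, div_add_div _ _ hyq.1 hyq.2]
    simp
  mul := by
    intro U f g hf hg x hx
    obtain ⟨p, q, hq, e⟩ := hf x hx
    obtain ⟨r, s, hs, e'⟩ := hg x hx
    refine ⟨p * r, q * s, by simp [hq, hs], fun y hy hyq => ?_⟩
    simp only [map_mul, ne_eq, mul_eq_zero, not_or] at hyq
    beta_reduce
    rw [e y hy hyq.1, e' y hy hyq.2, div_mul_div_comm]
    simp
  inv := by
    intro U f hf hf0 x hx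
    obtain ⟨p, q, hq, e⟩ := hf x hx
    have hp : MvPolynomial.aeval x p ≠ 0 := by
      intro h
      exact hf0 x hx (by rw [e x hx hq, h, zero_div])
    -- The fraction is not reduced: the factor `q` in the denominator keeps the formula within the
    -- domain of validity of `p / q`.
    refine ⟨q * q, p * q, by simp [hq, hp], fun y hy hyq => ?_⟩
    simp only [map_mul, ne_eq, mul_eq_zero, not_or] at hyq
    beta_reduce
    rw [e y hy hyq.2, inv_div, map_mul, map_mul, mul_div_mul_right _ _ hyq.2]
  isOpen_ne := by
    intro U f hU hf
    refine isOpen_of_forall fun x ⟨hx, hfx⟩ => ?_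
    obtain ⟨p, q, hq, e⟩ := hf x hx
    obtain ⟨r, hr, hr'⟩ := exists_aeval_ne_zero hU hx
    have hp : MvPolynomial.aeval x p ≠ 0 := by
      intro h
      exact hfx (by rw [e x hx hq, h, zero_div])
    refine ⟨_, isOpen_aeval_ne_zero (p * q * r), by simp [hp, hq, hr], fun y hy => ?_⟩
    simp only [map_mul, ne_eq, mul_eq_zero, not_or, Set.mem_ofPred_eq] at hy
    refine ⟨hr' y hy.2, ?_⟩
    rw [e y (hr' y hy.2) hy.1.2]
    exact div_ne_zero hy.1.1 hy.1.2

/-- Universal property of the induced structure. Regular functions there extend only locally to the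
ambient space, which is why locality on the source is needed. -/
theorem Hom.into_induced {A : FunSpace K X} (hA : IsGood k A) {B : FunSpace K Z} {i : Y → Z}
    {f : X → Y} (h : Hom A B (i ∘ f)) : Hom A (B.induced i) f where
  isOpen_preimage := by
    rintro _ ⟨U, hU, rfl⟩
    exact h.isOpen_preimage U hU
  regular_comp := by
    intro U hU g hg
    refine hA.locality fun x hx => ?_
    obtain ⟨V, hV, hxV, r, hr, e⟩ := hg (f x) hx
    exact ⟨_, h.isOpen_preimage V hV, hxV, hA.congr (fun y hy => (e (f y) hy.1 hy.2).symm)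
      (hA.mono Set.inter_subset_right (h.regular_comp V hV r hr))⟩

theorem IsGood.regular_aeval {A : FunSpace K X} (hA : IsGood k A) {σ : Type*} {f : X → σ → K}
    {U : Set X} (hf : ∀ i, A.regular U fun x => f x i) (q : MvPolynomial σ k) :
    A.regular U fun x => MvPolynomial.aeval (f x) q := by
  induction q using MvPolynomial.induction_on with
  | C c => simpa using hA.const U c
  | add p q hp hq => simpa using hA.add hp hq
  | mul_X p i hp => simpa using hA.mul hp (hf i)

/-- Polynomials in regular functions are regular, and so are their quotients where the denominator
does not vanish; hence the coordinates suffice. -/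
theorem Hom.into_affineSpace {A : FunSpace K X} (hA : IsGood k A) {σ : Type*} {f : X → σ → K}
    (hf : ∀ i, A.regular Set.univ fun x => f x i) : Hom A (affineSpace k K σ) f where
  isOpen_preimage := by
    intro U hU
    refine isOpen_of_forall fun x hx => ?_
    obtain ⟨q, hq, hq'⟩ := exists_aeval_ne_zero hU hx
    exact ⟨_, hA.isOpen_ne (isOpen_univ A) (hA.regular_aeval hf q), ⟨trivial, hq⟩,
      fun y hy => hq' _ hy.2⟩
  regular_comp := by
    intro U hU g hg
    refine hA.locality fun x hx => ?_
    obtain ⟨p, q, hq, e⟩ := hg (f x) hx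
    refine ⟨_, hA.isOpen_ne (isOpen_univ A) (hA.regular_aeval hf q), ⟨trivial, hq⟩,
      hA.congr (fun y hy => (e (f y) hy.1 hy.2.2).symm) (hA.div
        (hA.mono (Set.subset_univ _) (hA.regular_aeval hf p))
        (hA.mono (Set.subset_univ _) (hA.regular_aeval hf q)) fun y hy => hy.2.2)⟩

theorem regular_coord {σ : Type*} (i : σ) (U : Set (σ → K)) :
    (affineSpace k K σ).regular U fun x => x i :=
  fun _ _ => ⟨MvPolynomial.X i, 1, by simp, by simp⟩

theorem Hom.regular_coord {A : FunSpace K X} {σ : Type*} {f : X → σ → K}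
    (hf : Hom A (affineSpace k K σ) f) (i : σ) : A.regular Set.univ fun x => f x i :=
  hf.regular (g := fun x => x i) (FunSpace.regular_coord i _)

/-- A map on an open subset of a quotient is a morphism as soon as its pull-back is. -/
theorem Hom.of_comp_quotient_restrict {A : FunSpace K X} (hA : IsGood k A) {B : FunSpace K Z}
    {π : X → Y} {S : Set Y} (hS : IsOpen[A.top] (π ⁻¹' S)) {f : S → Z}
    (h : Hom (A.induced (Subtype.val : π ⁻¹' S → X)) B fun x => f ⟨π x.1, x.2⟩) :
    Hom ((A.quotient π).induced (Subtype.val : S → Y)) B f := by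
  classical
  -- Restricting and passing to the quotient commute on an open subset: the preimage under `π` of
  -- such an image is the trace on the open set `π ⁻¹' S` of an open set.
  have hopen : ∀ V, IsOpen[B.top] V → IsOpen[(A.quotient π).top] (Subtype.val '' (f ⁻¹' V)) := by
    intro V hV
    obtain ⟨W, hW, e⟩ := h.isOpen_preimage V hV
    have : π ⁻¹' (Subtype.val '' (f ⁻¹' V)) = W ∩ π ⁻¹' S := by
      ext x
      have hx := fun hxS : π x ∈ S => Set.ext_iff.1 e ⟨x, hxS⟩
      constructor
      · rintro ⟨⟨y, hy⟩, hyV, hyx⟩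
        subst hyx
        exact ⟨(hx hy).2 hyV, hy⟩
      · rintro ⟨hxW, hxS⟩
        exact ⟨⟨π x, hxS⟩, (hx hxS).1 hxW, rfl⟩
    change IsOpen[A.top] _
    rw [this]
    exact isOpen_inter hW hS
  constructor
  · intro V hV
    refine ⟨_, hopen V hV, Set.preimage_image_eq _ Subtype.val_injective⟩
  · intro V hV g hg y hy
    -- Functions are total, so `g ∘ f` is extended by the arbitrary value `0` outside `S`. Only its
    -- values on the open set inside `S` matter.
    refine ⟨_, hopen V hV, ⟨y, hy, rfl⟩, fun y => if hy : y ∈ S then g (f ⟨y, hy⟩) else 0, ?_,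
      fun y _ _ => by simp⟩
    refine hA.locality ?_
    rintro x ⟨⟨y, hy⟩, hyV, hyx⟩
    subst hyx
    obtain ⟨W, hW, hxW, r, hr, e⟩ := h.regular_comp V hV g hg ⟨x, hy⟩ hyV
    refine ⟨W, hW, hxW, hA.congr ?_ (hA.mono Set.inter_subset_right hr)⟩
    rintro x' ⟨⟨⟨y', hy'⟩, hyV', hyx'⟩, hxW'⟩
    subst hyx'
    have := e ⟨x', hy'⟩ hyV' hxW'
    simp only [Function.comp_apply] at this
    simp [← this, hy']

end

end FunSpace

/-! ### Irreducibility of the quintic by Eisenstein's criterion -/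

section Irreducibility

open MvPolynomial

theorem F3_isHomogeneous (R : Type*) [CommRing R] : (F3 R).IsHomogeneous 3 := by
  have h (i : Fin 4) : (X i : MvPolynomial (Fin 4) R).IsHomogeneous 1 := isHomogeneous_X R i
  have h2 : (2 : MvPolynomial (Fin 4) R).IsHomogeneous 0 := isHomogeneous_C _ (2 : R)
  refine ((((h 1).add (h 2)).add (h 3)).pow 3).add (((((h 1).pow 2).mul (h 3)).add
    ((h 1).mul ((h 2).pow 2))).add ((h 2).mul ((h 3).pow 2))) |>.add ?_
  exact ((h2.mul (h 1)).mul (h 2)).mul (h 3)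

theorem F5_isHomogeneous (R : Type*) [CommRing R] : (F5 R).IsHomogeneous 5 := by
  have h (i : Fin 4) : (X i : MvPolynomial (Fin 4) R).IsHomogeneous 1 := isHomogeneous_X R i
  refine (((((h 3).pow 3).mul ((h 1).pow 2)).add (((h 1).pow 3).mul ((h 2).pow 2))).add
    (((h 2).pow 3).mul ((h 3).pow 2))).sub ?_
  exact (((h 1).mul (h 2)).mul (h 3)).mul ((((h 2).mul (h 3)).add ((h 1).mul (h 2))).add
    ((h 1).mul (h 3)))

theorem quintic_isHomogeneous (R : Type*) [CommRing R] : (quintic R).IsHomogeneous 5 :=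
  (((isHomogeneous_X R 0).pow 2).mul (F3_isHomogeneous R)).sub (F5_isHomogeneous R)

theorem boundaryPoly_isHomogeneous (R : Type*) [CommRing R] :
    (boundaryPoly R).IsHomogeneous 14 := by
  have h (i : Fin 4) : (X i : MvPolynomial (Fin 4) R).IsHomogeneous 1 := isHomogeneous_X R i
  have h2 (i j : Fin 4) : (X i ^ 2 - X j ^ 2 : MvPolynomial (Fin 4) R).IsHomogeneous 2 :=
    ((h i).pow 2).sub ((h j).pow 2)
  have hq : (X 0 ^ 2 + X 1 * X 2 + X 2 * X 3 + X 1 * X 3 :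
      MvPolynomial (Fin 4) R).IsHomogeneous 2 :=
    ((((h 0).pow 2).add ((h 1).mul (h 2))).add ((h 2).mul (h 3))).add ((h 1).mul (h 3))
  exact (((((hq.mul (h2 0 1)).mul (h2 0 2)).mul (h2 0 3)).mul (h2 1 2)).mul (h2 2 3)).mul (h2 1 3)

theorem boundaryPoly_ne_zero (R : Type*) [CommRing R] [CharZero R] : boundaryPoly R ≠ 0 := by
  intro h
  have := congrArg (eval ![0, 1, 2, 3]) h
  have e : eval ![0, 1, 2, 3] (boundaryPoly R) = ((47520 : ℕ) : R) := by
    simp [boundaryPoly]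
    norm_num
  rw [e] at this
  simp at this

/-- `F₃` in the variables `X, Y, Z`. -/
def cubicXYZ (R : Type*) [CommRing R] : MvPolynomial (Fin 3) R :=
  (X 0 + X 1 + X 2) ^ 3 + (X 0 ^ 2 * X 2 + X 0 * X 1 ^ 2 + X 1 * X 2 ^ 2) + 2 * X 0 * X 1 * X 2

/-- `F₅` in the variables `X, Y, Z`. -/
def quinticXYZ (R : Type*) [CommRing R] : MvPolynomial (Fin 3) R :=
  (X 2 ^ 3 * X 0 ^ 2 + X 0 ^ 3 * X 1 ^ 2 + X 1 ^ 3 * X 2 ^ 2) -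
    X 0 * X 1 * X 2 * (X 1 * X 2 + X 0 * X 1 + X 0 * X 2)

/-- By the Leibniz rule a derivation maps `m²` into `m`. A polynomial with a nonzero partial
derivative at a point is therefore outside the square of the maximal ideal there. -/
theorem pderiv_mem_ker_eval {σ K : Type*} [Field K] (x : σ → K) (i : σ) {p : MvPolynomial σ K}
    (hp : p ∈ RingHom.ker (eval x) ^ 2) : pderiv i p ∈ RingHom.ker (eval x) := by
  rw [pow_two] at hp
  induction hp using Submodule.mul_induction_on' with
  | mem_mul_mem a ha b hb =>
    rw [RingHom.mem_ker] at *
    simp [ha, hb]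
  | add a _ b _ ha hb => simpa using add_mem ha hb

/-- The cubic is monic in `X`, so a divisor of it has a unit as leading coefficient and keeps its
degree in `X` under the specialization `Y = 0, Z = 1`. There the two forms become `(X + 1)³ + X²`
and `X²`, which are coprime. A common divisor thus has degree zero in `X`, and equals its unit
leading coefficient. -/
theorem isUnit_of_dvd_cubicXYZ_of_dvd_quinticXYZ {K : Type*} [Field K] {r : MvPolynomial (Fin 3) K}
    (h3 : r ∣ cubicXYZ K) (h5 : r ∣ quinticXYZ K) : IsUnit r := by
  let e := finSuccEquiv K 2
  have e0 : e (X 0) = Polynomial.X := finSuccEquiv_X_zero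
  have e1 : e (X 1) = Polynomial.C (X 0) := finSuccEquiv_X_succ (j := 0)
  have e2 : e (X 2) = Polynomial.C (X 1) := finSuccEquiv_X_succ (j := 1)
  let φ : MvPolynomial (Fin 2) K →+* K := eval ![0, 1]
  have hm : (e (cubicXYZ K)).Monic := by
    have : e (cubicXYZ K) = Polynomial.X ^ 3 +
        (Polynomial.C (3 * (X 0 + X 1) + X 1) * Polynomial.X ^ 2 +
        Polynomial.C (3 * (X 0 + X 1) ^ 2 + X 0 ^ 2 + 2 * X 0 * X 1) * Polynomial.X +
        Polynomial.C ((X 0 + X 1) ^ 3 + X 0 * X 1 ^ 2)) := by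
      simp only [cubicXYZ, map_add, map_mul, map_pow, e0, e1, e2, map_ofNat]
      ring
    rw [this]
    exact Polynomial.monic_X_pow_add Polynomial.degree_quadratic_lt
  obtain ⟨s, hs⟩ := h3
  obtain ⟨t, ht⟩ := h5
  have hu : IsUnit (e r).leadingCoeff :=
    hm.isUnit_leadingCoeff_of_dvd ⟨e s, by rw [hs, map_mul]⟩
  let ψ : MvPolynomial (Fin 3) K →+* Polynomial K :=
    (Polynomial.mapRingHom φ).comp (e : MvPolynomial (Fin 3) K →+* _)
  have ψ0 : ψ (X 0) = Polynomial.X := by simp [ψ, e0]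
  have ψ1 : ψ (X 1) = 0 := by simp [ψ, e1, φ]
  have ψ2 : ψ (X 2) = 1 := by simp [ψ, e2, φ]
  -- An explicit Bézout identity for the two specializations.
  have h : ψ r * ((1 - 3 * Polynomial.X) * ψ s + (5 + 11 * Polynomial.X +
      3 * Polynomial.X ^ 2) * ψ t) = 1 := by
    have h3 : ψ r * ψ s = (Polynomial.X + 1) ^ 3 + Polynomial.X ^ 2 := by
      rw [← map_mul, ← hs]
      simp [cubicXYZ, ψ0, ψ1, ψ2]
    have h5 : ψ r * ψ t = Polynomial.X ^ 2 := by
      rw [← map_mul, ← ht]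
      simp [quinticXYZ, ψ0, ψ1, ψ2]
    linear_combination (1 - 3 * Polynomial.X) * h3 +
      (5 + 11 * Polynomial.X + 3 * Polynomial.X ^ 2) * h5
  have hd : (e r).degree = 0 := by
    rw [← Polynomial.degree_map_eq_of_isUnit_leadingCoeff φ hu]
    exact Polynomial.degree_eq_zero_of_isUnit (IsUnit.of_mul_eq_one _ h)
  rw [Polynomial.eq_C_of_degree_eq_zero hd] at hu
  rw [← MulEquiv.isUnit_map e, Polynomial.eq_C_of_degree_eq_zero hd]
  exact Polynomial.isUnit_C.2 (by simpa using hu)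

/-- The zero linear term is kept so that the lemmas on the degree and leading coefficient of a
quadratic polynomial apply. -/
theorem finSuccEquiv_quintic (K : Type*) [Field K] :
    finSuccEquiv K 3 (quintic K) =
      Polynomial.C (cubicXYZ K) * Polynomial.X ^ 2 + Polynomial.C 0 * Polynomial.X +
        Polynomial.C (- quinticXYZ K) := by
  have e0 : finSuccEquiv K 3 (X 0) = Polynomial.X := finSuccEquiv_X_zero
  have e1 : finSuccEquiv K 3 (X 1) = Polynomial.C (X 0) := finSuccEquiv_X_succ (j := 0)
  have e2 : finSuccEquiv K 3 (X 2) = Polynomial.C (X 1) := finSuccEquiv_X_succ (j := 1)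
  have e3 : finSuccEquiv K 3 (X 3) = Polynomial.C (X 2) := finSuccEquiv_X_succ (j := 2)
  simp only [quintic, F3, F5, cubicXYZ, quinticXYZ, map_add, map_sub, map_mul, map_pow, map_neg,
    e0, e1, e2, e3, map_ofNat, map_zero]
  ring

/-- Eisenstein's criterion at the ideal of a point `(r, 1, 2)` with `F₅ = 0`, `F₃ ≠ 0` and `∂F₅/∂X ≠
0`. The coprimality of `F₃` and `F₅` makes the polynomial in `W` primitive. -/
theorem quintic_irreducible (K : Type*) [Field K] [IsAlgClosed K] [CharZero K] :
    Irreducible (quintic K) := by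
  -- The cubic is `F₅(X, 1, 2)`.
  obtain ⟨r, hr⟩ := IsAlgClosed.exists_root (Polynomial.C (1 : K) * Polynomial.X ^ 3 +
    Polynomial.C 2 * Polynomial.X ^ 2 + Polynomial.C (-4) * Polynomial.X + Polynomial.C 4)
    (by rw [Polynomial.degree_cubic one_ne_zero]; simp)
  replace hr : r ^ 3 + 2 * r ^ 2 - 4 * r + 4 = 0 := by
    simp [Polynomial.IsRoot] at hr
    linear_combination hr
  let P := RingHom.ker (eval ![r, 1, 2])
  have h3 : cubicXYZ K ∉ P := by
    intro h
    replace h : r ^ 3 + 11 * r ^ 2 + 32 * r + 31 = 0 := by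
      simp [P, cubicXYZ] at h
      linear_combination h
    -- Elimination of `r` from `F₃(r, 1, 2) = 0` and `F₅(r, 1, 2) = 0`; the resulting constant is
    -- nonzero in characteristic zero.
    have : (567 : K) = 0 := by
      linear_combination (13 - 8 * r + r ^ 2) * h + (41 - r - r ^ 2) * hr
    simp at this
  have h0 : cubicXYZ K ≠ 0 := fun h => h3 (h ▸ P.zero_mem)
  have h5 : quinticXYZ K ∈ P := by
    simp [P, quinticXYZ]
    linear_combination hr
  have h5' : - quinticXYZ K ∉ P ^ 2 := by
    intro h
    have h' := pderiv_mem_ker_eval _ 0 (neg_mem_iff.1 h)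
    simp [quinticXYZ, pderiv_X] at h'
    -- Elimination of `r` from `F₅(X, 1, 2)` and its derivative, so that `r` is not a multiple root.
    have : (1836 : K) = 0 := by
      linear_combination (585 + 216 * r) * hr + (126 - 243 * r - 72 * r ^ 2) * h'
    simp at this
  refine (MulEquiv.irreducible_iff (finSuccEquiv K 3)).1 ?_
  rw [finSuccEquiv_quintic]
  have hdeg := Polynomial.degree_quadratic (b := 0) (c := - quinticXYZ K) h0
  refine Polynomial.irreducible_of_eisenstein_criterion (P := P) (RingHom.ker_isPrime _)
    ?_ ?_ ?_ ?_ ?_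
  · rwa [Polynomial.leadingCoeff_quadratic h0]
  · intro n hn
    rw [hdeg] at hn
    have : n < 2 := by exact_mod_cast hn
    interval_cases n
    · simpa using h5
    · simp
  · rw [hdeg]
    norm_num
  · simpa using h5'
  · intro s hs
    rw [Polynomial.C_dvd_iff_dvd_coeff] at hs
    exact isUnit_of_dvd_cubicXYZ_of_dvd_quinticXYZ (by simpa [Polynomial.coeff_X] using hs 2)
      (by simpa using hs 0)

end Irreducibility

/-! ### Equations of the boundary curves, and their distinctness -/

section Curves

open MvPolynomial

theorem eval_smul_of_isHomogeneous {K : Type*} [Field K] {n d : ℕ} {q : MvPolynomial (Fin n) K}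
    (hq : q.IsHomogeneous d) (c : K) (v : Fin n → K) : eval (c • v) q = c ^ d * eval v q := by
  rw [eval_eq', eval_eq', Finset.mul_sum]
  refine Finset.sum_congr rfl fun m hm => ?_
  have hd : ∑ i, m i = d := by
    have := hq (mem_support_iff.1 hm)
    rwa [Finsupp.weight_apply, Finsupp.sum_fintype _ _ (by simp), ← Finset.sum_congr rfl
      (fun i _ => show m i = m i • (1 : Fin n → ℕ) i by simp)] at this
  simp only [Pi.smul_apply, smul_eq_mul, mul_pow, Finset.prod_mul_distrib,
    Finset.prod_pow_eq_pow_sum, hd]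
  ring

/-- Zero loci are defined through the chosen representative of a point; homogeneity removes the
dependence on that choice. -/
theorem mk_mem_projZeros {K : Type*} [Field K] {n d : ℕ} {q : MvPolynomial (Fin n) K}
    (hq : q.IsHomogeneous d) {v : Fin n → K} (hv : v ≠ 0) :
    Projectivization.mk K v hv ∈ projZeros q ↔ eval v q = 0 := by
  obtain ⟨c, hc⟩ := Projectivization.exists_smul_eq_mk_rep K v hv
  change eval _ q = 0 ↔ _
  rw [← hc, Units.smul_def, eval_smul_of_isHomogeneous hq]
  simp

variable (K : Type*) [Field K]

theorem lineEq_isHomogeneous (i : Fin 9) :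
    (lineEq K i).1.IsHomogeneous 1 ∧ (lineEq K i).2.IsHomogeneous 1 := by
  have h (i : Fin 4) : (X i : MvPolynomial (Fin 4) K).IsHomogeneous 1 := isHomogeneous_X K i
  fin_cases i <;> exact ⟨(h _).sub (h _), (h _).add (h _)⟩

theorem conicEq_isHomogeneous (i : Fin 14) :
    (conicEq K i).1.IsHomogeneous 1 ∧ (conicEq K i).2.IsHomogeneous 2 := by
  have h (i : Fin 4) : (X i : MvPolynomial (Fin 4) K).IsHomogeneous 1 := isHomogeneous_X K i
  have h3 : (3 : MvPolynomial (Fin 4) K).IsHomogeneous 0 := isHomogeneous_C _ (3 : K)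
  have hm (i j : Fin 4) : (X i * X j : MvPolynomial (Fin 4) K).IsHomogeneous 2 := (h i).mul (h j)
  have hs (i : Fin 4) : (X i ^ 2 : MvPolynomial (Fin 4) K).IsHomogeneous 2 := (h i).pow 2
  have h3m (i j : Fin 4) : (3 * X i * X j : MvPolynomial (Fin 4) K).IsHomogeneous 2 :=
    (h3.mul (h i)).mul (h j)
  have hc1 := (((hs 1).add (hs 2)).add (hs 3)).add
    (h3.mul (((hm 1 2).add (hm 1 3)).add (hm 2 3)))
  have hl := ((h 1).add (h 2)).add (h 3)
  have hc2 (i j l : Fin 4) := (((hs i).add (hm i j)).add (h3m i l)).sub (hm j l)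
  have hl3 (i j : Fin 4) : (X 0 * (X i + 3 * X j) : MvPolynomial (Fin 4) K).IsHomogeneous 2 :=
    (h 0).mul ((h i).add (h3.mul (h j)))
  have hx (i j : Fin 4) : (X i * (X i - X j) : MvPolynomial (Fin 4) K).IsHomogeneous 2 :=
    (h i).mul ((h i).sub (h j))
  fin_cases i
  · exact ⟨(h 0).sub hl, hc1⟩
  · exact ⟨(h 0).add hl, hc1⟩
  · exact ⟨(h 0).sub (h 1), hc2 1 2 3⟩
  · exact ⟨(h 0).add (h 1), hc2 1 2 3⟩
  · exact ⟨(h 0).sub (h 2), hc2 2 3 1⟩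
  · exact ⟨(h 0).add (h 2), hc2 2 3 1⟩
  · exact ⟨(h 0).sub (h 3), hc2 3 1 2⟩
  · exact ⟨(h 0).add (h 3), hc2 3 1 2⟩
  · exact ⟨(h 3).sub (h 1), (hl3 2 1).add (hx 1 2)⟩
  · exact ⟨(h 3).sub (h 1), (hl3 2 1).sub (hx 1 2)⟩
  · exact ⟨(h 2).sub (h 3), (hl3 1 3).add (hx 3 1)⟩
  · exact ⟨(h 2).sub (h 3), (hl3 1 3).sub (hx 3 1)⟩
  · exact ⟨(h 1).sub (h 2), (hl3 3 2).add (hx 2 3)⟩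
  · exact ⟨(h 1).sub (h 2), (hl3 3 2).sub (hx 2 3)⟩

/-- The values at `v` of the pairs of equations of the nine lines. -/
def lineVal {R : Type*} [CommRing R] (v : Fin 4 → R) : Fin 9 → R × R :=
  ![(v 0 - v 3, v 0 + v 2),
    (v 0 - v 2, v 0 + v 3),
    (v 0 - v 2, v 0 + v 1),
    (v 0 - v 1, v 0 + v 2),
    (v 0 - v 1, v 0 + v 3),
    (v 0 - v 3, v 0 + v 1),
    (v 2 - v 3, v 2 + v 1),
    (v 1 - v 3, v 1 + v 2),
    (v 1 - v 2, v 1 + v 3)]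

/-- The values at `v` of the pairs of equations of the fourteen conics. -/
def conicVal {R : Type*} [CommRing R] (v : Fin 4 → R) : Fin 14 → R × R :=
  ![(v 0 - (v 1 + v 2 + v 3),
      v 1 ^ 2 + v 2 ^ 2 + v 3 ^ 2 + 3 * (v 1 * v 2 + v 1 * v 3 + v 2 * v 3)),
    (v 0 + (v 1 + v 2 + v 3),
      v 1 ^ 2 + v 2 ^ 2 + v 3 ^ 2 + 3 * (v 1 * v 2 + v 1 * v 3 + v 2 * v 3)),
    (v 0 - v 1, v 1 ^ 2 + v 1 * v 2 + 3 * v 1 * v 3 - v 2 * v 3),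
    (v 0 + v 1, v 1 ^ 2 + v 1 * v 2 + 3 * v 1 * v 3 - v 2 * v 3),
    (v 0 - v 2, v 2 ^ 2 + v 2 * v 3 + 3 * v 2 * v 1 - v 3 * v 1),
    (v 0 + v 2, v 2 ^ 2 + v 2 * v 3 + 3 * v 2 * v 1 - v 3 * v 1),
    (v 0 - v 3, v 3 ^ 2 + v 3 * v 1 + 3 * v 3 * v 2 - v 1 * v 2),
    (v 0 + v 3, v 3 ^ 2 + v 3 * v 1 + 3 * v 3 * v 2 - v 1 * v 2),
    (v 3 - v 1, v 0 * (v 2 + 3 * v 1) + v 1 * (v 1 - v 2)),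
    (v 3 - v 1, v 0 * (v 2 + 3 * v 1) - v 1 * (v 1 - v 2)),
    (v 2 - v 3, v 0 * (v 1 + 3 * v 3) + v 3 * (v 3 - v 1)),
    (v 2 - v 3, v 0 * (v 1 + 3 * v 3) - v 3 * (v 3 - v 1)),
    (v 1 - v 2, v 0 * (v 3 + 3 * v 2) + v 2 * (v 2 - v 3)),
    (v 1 - v 2, v 0 * (v 3 + 3 * v 2) - v 2 * (v 2 - v 3))]

variable {K}

theorem eval_lineEq (v : Fin 4 → K) (i : Fin 9) :
    (eval v (lineEq K i).1, eval v (lineEq K i).2) = lineVal v i := by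
  fin_cases i <;> simp [lineEq, lineVal]

theorem eval_conicEq (v : Fin 4 → K) (i : Fin 14) :
    (eval v (conicEq K i).1, eval v (conicEq K i).2) = conicVal v i := by
  fin_cases i <;> simp [conicEq, conicVal]

theorem mem_lineCurve {p : ℙ K (Fin 4 → K)} {i : Fin 9} :
    p ∈ lineCurve K i ↔ lineVal p.rep i = 0 := by
  rw [← eval_lineEq, Prod.mk_eq_zero]
  rfl

theorem mem_conicCurve {p : ℙ K (Fin 4 → K)} {i : Fin 14} :
    p ∈ conicCurve K i ↔ conicVal p.rep i = 0 := by
  rw [← eval_conicEq, Prod.mk_eq_zero]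
  rfl

theorem mk_mem_lineCurve {v : Fin 4 → K} (hv : v ≠ 0) {i : Fin 9} :
    Projectivization.mk K v hv ∈ lineCurve K i ↔ lineVal v i = 0 := by
  rw [← eval_lineEq, Prod.mk_eq_zero]
  exact and_congr (mk_mem_projZeros (lineEq_isHomogeneous K i).1 hv)
    (mk_mem_projZeros (lineEq_isHomogeneous K i).2 hv)

theorem mk_mem_conicCurve {v : Fin 4 → K} (hv : v ≠ 0) {i : Fin 14} :
    Projectivization.mk K v hv ∈ conicCurve K i ↔ conicVal v i = 0 := by
  rw [← eval_conicEq, Prod.mk_eq_zero]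
  exact and_congr (mk_mem_projZeros (conicEq_isHomogeneous K i).1 hv)
    (mk_mem_projZeros (conicEq_isHomogeneous K i).2 hv)

/-- A point of each of the nine lines that lies on no other curve. -/
def linePoint : Fin 9 → Fin 4 → ℤ :=
  ![![-2, -1, 2, -2], ![-2, -1, -2, 2], ![-2, 2, -2, -1], ![-2, -2, 2, -1], ![-2, -2, -1, 2],
    ![-2, 2, -1, -2], ![0, -1, 1, 1], ![0, -1, 1, -1], ![0, -1, -1, 1]]

/-- A point of each of the fourteen conics that lies on no other curve. -/
def conicPoint : Fin 14 → Fin 4 → ℤ :=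
  ![![7, 1, 11, -5], ![-7, 1, 11, -5], ![-3, -3, 0, 1], ![-3, 3, 0, -1], ![-3, 1, -3, 0],
    ![-3, -1, 3, 0], ![-3, 0, 1, -3], ![-3, 0, -1, 3], ![-3, 1, -2, 1], ![-3, -1, 2, -1],
    ![-3, -2, 1, 1], ![-3, 2, -1, -1], ![-3, 1, 1, -2], ![-3, -1, -1, 2]]

/-- In characteristic zero, incidence of integral points can be tested over `ℤ`, where it is
decidable. -/
theorem lineVal_intCast [CharZero K] (v : Fin 4 → ℤ) (i : Fin 9) :
    lineVal (fun j => (v j : K)) i = 0 ↔ lineVal v i = 0 := by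
  have : lineVal (fun j => (v j : K)) i = Prod.map Int.cast Int.cast (lineVal v i) := by
    fin_cases i <;> simp [lineVal]
  rw [this]
  simp [Prod.ext_iff]

theorem conicVal_intCast [CharZero K] (v : Fin 4 → ℤ) (i : Fin 14) :
    conicVal (fun j => (v j : K)) i = 0 ↔ conicVal v i = 0 := by
  have : conicVal (fun j => (v j : K)) i = Prod.map Int.cast Int.cast (conicVal v i) := by
    fin_cases i <;> simp [conicVal]
  rw [this]
  simp [Prod.ext_iff]

/-- Each curve contains an integral point that lies on no other curve of its kind. The points chosen
on the lines also avoid every conic, which separates lines from conics. -/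
theorem curves_injective [CharZero K] :
    Function.Injective (Sum.elim (lineCurve K) (conicCurve K)) := by
  have h0 {v : Fin 4 → ℤ} (hv : v ≠ 0) : (fun j => (v j : K)) ≠ 0 := by
    contrapose! hv
    ext j
    simpa using congrFun hv j
  have hl (i : Fin 9) : linePoint i ≠ 0 := by revert i; decide
  have hc (i : Fin 14) : conicPoint i ≠ 0 := by revert i; decide
  have hll (i j : Fin 9) : Projectivization.mk K _ (h0 (hl i)) ∈ lineCurve K j ↔ i = j := by
    rw [mk_mem_lineCurve, lineVal_intCast]
    revert i j
    decide
  have hlc (i : Fin 9) (j : Fin 14) :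
      Projectivization.mk K _ (h0 (hl i)) ∉ conicCurve K j := by
    rw [mk_mem_conicCurve, conicVal_intCast]
    revert i j
    decide
  have hcc (i j : Fin 14) : Projectivization.mk K _ (h0 (hc i)) ∈ conicCurve K j ↔ i = j := by
    rw [mk_mem_conicCurve, conicVal_intCast]
    revert i j
    decide
  rintro (i | i) (j | j) h
  · have : _ ∈ lineCurve K i := (hll i i).2 rfl
    rw [show lineCurve K i = lineCurve K j from h, hll] at this
    rw [this]
  · have : _ ∈ lineCurve K i := (hll i i).2 rfl
    rw [show lineCurve K i = conicCurve K j from h] at this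
    exact absurd this (hlc i j)
  · have : _ ∈ lineCurve K j := (hll j j).2 rfl
    rw [show lineCurve K j = conicCurve K i from h.symm] at this
    exact absurd this (hlc j i)
  · have : _ ∈ conicCurve K i := (hcc i i).2 rfl
    rw [show conicCurve K i = conicCurve K j from h, hcc] at this
    rw [this]

end Curves

/-! ### Parametrizations of the lines and conics -/

section Curves

open MvPolynomial Matrix

/-- The form has degree one in the first variable, with coprime coefficients. -/
theorem irreducible_X_mul_X_sub_X_sq (K : Type*) [Field K] :
    Irreducible (X 0 * X 2 - X 1 ^ 2 : MvPolynomial (Fin 3) K) := by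
  refine (MulEquiv.irreducible_iff (finSuccEquiv K 2)).1 ?_
  have e0 : finSuccEquiv K 2 (X 0) = Polynomial.X := finSuccEquiv_X_zero
  have e1 : finSuccEquiv K 2 (X 1) = Polynomial.C (X 0) := finSuccEquiv_X_succ (j := 0)
  have e2 : finSuccEquiv K 2 (X 2) = Polynomial.C (X 1) := finSuccEquiv_X_succ (j := 1)
  have : finSuccEquiv K 2 (X 0 * X 2 - X 1 ^ 2) =
      Polynomial.C (X 1) * Polynomial.X + Polynomial.C (- X 0 ^ 2) := by
    simp only [map_sub, map_mul, map_pow, map_neg, e0, e1, e2]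
    ring
  rw [this]
  refine Polynomial.irreducible_C_mul_X_add_C (X_ne_zero _) ?_
  rw [(X_prime (i := (1 : Fin 2)) (R := K)).irreducible.isRelPrime_iff_not_dvd]
  rintro ⟨s, hs⟩
  simpa using congrArg (eval ![1, 0]) hs

variable {K : Type*} [Field K]

/-- Inverses up to the factor `2` allow the parametrizations to be given by integer matrices in both
directions. -/
theorem mulVec_injective_of_two_smul [CharZero K] {m n : ℕ} {M : Matrix (Fin n) (Fin m) K}
    {N : Matrix (Fin m) (Fin n) K} (h : ∀ x, N *ᵥ (M *ᵥ x) = (2 : K) • x) :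
    Function.Injective M.mulVecLin := by
  intro x y hxy
  have : (2 : K) • x = (2 : K) • y := by
    rw [← h x, ← h y]
    exact congrArg _ hxy
  exact smul_right_injective _ two_ne_zero this

theorem isLine_of_matrix [CharZero K] {i : Fin 9} {M : Matrix (Fin 4) (Fin 2) K}
    {N : Matrix (Fin 2) (Fin 4) K} (h : ∀ x, N *ᵥ (M *ᵥ x) = (2 : K) • x)
    (hM : ∀ x, lineVal (M *ᵥ x) i = 0) (hN : ∀ v, lineVal v i = 0 → M *ᵥ (N *ᵥ v) = (2 : K) • v) :
    IsLine (lineCurve K i) := by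
  refine ⟨M.mulVecLin, mulVec_injective_of_two_smul h, ?_⟩
  ext p
  constructor
  · intro hp
    induction p using Projectivization.ind with | h v hv =>
    rw [mk_mem_lineCurve] at hp
    have hv' : N *ᵥ v ≠ 0 := by
      intro h0
      have := hN v hp
      rw [h0, mulVec_zero] at this
      exact hv ((smul_eq_zero.1 this.symm).resolve_left two_ne_zero)
    refine ⟨Projectivization.mk K _ hv', ?_⟩
    rw [Projectivization.map_mk, Projectivization.mk_eq_mk_iff']
    exact ⟨2, (hN v hp).symm⟩
  · rintro ⟨x, rfl⟩
    induction x using Projectivization.ind with | h x hx =>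
    rw [Projectivization.map_mk, mk_mem_lineCurve]
    exact hM x

/-- Every curve is brought to the standard conic `x₀x₂ = x₁²`. The outer columns of `M` are then two
points of the curve, and the middle column is the intersection of the tangents at these points. -/
theorem isConic_of_matrix [CharZero K] {i : Fin 14} {M : Matrix (Fin 4) (Fin 3) K}
    {N : Matrix (Fin 3) (Fin 4) K} {c : K} (hc : c ≠ 0)
    (h : ∀ x, N *ᵥ (M *ᵥ x) = (2 : K) • x)
    (hM : ∀ x, conicVal (M *ᵥ x) i = (0, c * (x 0 * x 2 - x 1 ^ 2)))
    (hN : ∀ v, (conicVal v i).1 = 0 → M *ᵥ (N *ᵥ v) = (2 : K) • v) :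
    IsConic (conicCurve K i) := by
  have hX (i : Fin 3) : (X i : MvPolynomial (Fin 3) K).IsHomogeneous 1 := isHomogeneous_X K i
  have hq : (X 0 * X 2 - X 1 ^ 2 : MvPolynomial (Fin 3) K).IsHomogeneous 2 :=
    ((hX 0).mul (hX 2)).sub ((hX 1).pow 2)
  have key {x : Fin 3 → K} (hx : x ≠ 0) :
      Projectivization.mk K x hx ∈ projZeros (X 0 * X 2 - X 1 ^ 2) ↔
        conicVal (M *ᵥ x) i = 0 := by
    rw [mk_mem_projZeros hq, hM]
    simp [hc]
  refine ⟨M.mulVecLin, mulVec_injective_of_two_smul h, X 0 * X 2 - X 1 ^ 2, hq,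
    irreducible_X_mul_X_sub_X_sq K, ?_⟩
  ext p
  constructor
  · intro hp
    induction p using Projectivization.ind with | h v hv =>
    have hvN := hN v (by rw [(mk_mem_conicCurve hv).1 hp]; rfl)
    have hv' : N *ᵥ v ≠ 0 := by
      intro h0
      rw [h0, mulVec_zero] at hvN
      exact hv ((smul_eq_zero.1 hvN.symm).resolve_left two_ne_zero)
    have e : Projectivization.mk K _ hv = Projectivization.map M.mulVecLin
        (mulVec_injective_of_two_smul h) (Projectivization.mk K _ hv') := by
      rw [Projectivization.map_mk, eq_comm, Projectivization.mk_eq_mk_iff']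
      exact ⟨2, hvN.symm⟩
    refine ⟨Projectivization.mk K _ hv', ?_, e.symm⟩
    rw [e, Projectivization.map_mk, mk_mem_conicCurve] at hp
    exact (key hv').2 hp
  · rintro ⟨x, hxq, rfl⟩
    induction x using Projectivization.ind with | h x hx =>
    rw [Projectivization.map_mk, mk_mem_conicCurve]
    exact (key hx).1 hxq

/-- A parametrization of each of the nine lines, and its inverse up to the factor `2`. -/
def lineParam (K : Type*) [Field K] : Fin 9 → Matrix (Fin 4) (Fin 2) K × Matrix (Fin 2) (Fin 4) K :=
  ![(!![2, 0; 0, 2; -2, 0; 2, 0], !![1, 0, 0, 0; 0, 1, 0, 0]),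
    (!![2, 0; 0, 2; 2, 0; -2, 0], !![1, 0, 0, 0; 0, 1, 0, 0]),
    (!![2, 0; -2, 0; 2, 0; 0, 2], !![1, 0, 0, 0; 0, 0, 0, 1]),
    (!![2, 0; 2, 0; -2, 0; 0, 2], !![1, 0, 0, 0; 0, 0, 0, 1]),
    (!![2, 0; 2, 0; 0, 2; -2, 0], !![1, 0, 0, 0; 0, 0, 1, 0]),
    (!![2, 0; -2, 0; 0, 2; 2, 0], !![1, 0, 0, 0; 0, 0, 1, 0]),
    (!![0, 2; -2, 0; 2, 0; 2, 0], !![0, 0, 1, 0; 1, 0, 0, 0]),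
    (!![0, 2; 2, 0; -2, 0; 2, 0], !![0, 1, 0, 0; 1, 0, 0, 0]),
    (!![0, 2; 2, 0; 2, 0; -2, 0], !![0, 1, 0, 0; 1, 0, 0, 0])]

/-- A linear parametrization of the plane of each of the fourteen conics, its inverse up to the
factor `2`, and a scalar `c` such that the quadratic form becomes `c * (x₀ * x₂ - x₁ ^ 2)`. -/
def conicParam (K : Type*) [Field K] :
    Fin 14 → Matrix (Fin 4) (Fin 3) K × Matrix (Fin 3) (Fin 4) K × K :=
  ![(!![1, -1, 1; 1, -3, 1; -1, 1, 1; 1, 1, -1],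
      !![0, 1, 1, 2; 0, 0, 1, 1; 0, 1, 2, 1], 4),
    (!![-1, 1, -1; 1, -3, 1; -1, 1, 1; 1, 1, -1],
      !![0, 1, 1, 2; 0, 0, 1, 1; 0, 1, 2, 1], 4),
    (!![0, 1, 0; 0, 1, 0; -2, 3, 0; 0, 1, -2],
      !![0, 3, -1, 0; 0, 2, 0, 0; 0, 1, 0, -1], -4),
    (!![0, -1, 0; 0, 1, 0; -2, 3, 0; 0, 1, -2],
      !![0, 3, -1, 0; 0, 2, 0, 0; 0, 1, 0, -1], -4),
    (!![0, 1, 0; 0, 1, -2; 0, 1, 0; -2, 3, 0],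
      !![0, 0, 3, -1; 0, 0, 2, 0; 0, -1, 1, 0], -4),
    (!![0, -1, 0; 0, 1, -2; 0, 1, 0; -2, 3, 0],
      !![0, 0, 3, -1; 0, 0, 2, 0; 0, -1, 1, 0], -4),
    (!![0, 1, 0; -2, 3, 0; 0, 1, -2; 0, 1, 0],
      !![0, -1, 0, 3; 0, 0, 0, 2; 0, 0, -1, 1], -4),
    (!![0, -1, 0; -2, 3, 0; 0, 1, -2; 0, 1, 0],
      !![0, -1, 0, 3; 0, 0, 0, 2; 0, 0, -1, 1], -4),
    (!![0, 1, -2; 0, 1, 0; 2, -3, 0; 0, 1, 0],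
      !![0, 3, 1, 0; 0, 2, 0, 0; -1, 1, 0, 0], -4),
    (!![0, -1, 2; 0, 1, 0; 2, -3, 0; 0, 1, 0],
      !![0, 3, 1, 0; 0, 2, 0, 0; 1, 1, 0, 0], 4),
    (!![0, 1, -2; 2, -3, 0; 0, 1, 0; 0, 1, 0],
      !![0, 1, 0, 3; 0, 0, 0, 2; -1, 0, 0, 1], -4),
    (!![0, -1, 2; 2, -3, 0; 0, 1, 0; 0, 1, 0],
      !![0, 1, 0, 3; 0, 0, 0, 2; 1, 0, 0, 1], 4),
    (!![0, 1, -2; 0, 1, 0; 0, 1, 0; 2, -3, 0],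
      !![0, 0, 3, 1; 0, 0, 2, 0; -1, 0, 1, 0], -4),
    (!![0, -1, 2; 0, 1, 0; 0, 1, 0; 2, -3, 0],
      !![0, 0, 3, 1; 0, 0, 2, 0; 1, 0, 1, 0], 4)]

theorem isLine_lineCurve [CharZero K] (i : Fin 9) : IsLine (lineCurve K i) := by
  refine isLine_of_matrix (M := (lineParam K i).1) (N := (lineParam K i).2)
    (fun x => ?_) (fun x => ?_) (fun v hv => ?_)
  · fin_cases i <;> ext j <;> fin_cases j <;>
      simp [lineParam, mulVec, dotProduct, Fin.sum_univ_succ]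
  · fin_cases i <;> simp [lineParam, lineVal, mulVec, dotProduct, Fin.sum_univ_succ]
  · fin_cases i <;> simp [lineVal] at hv <;> obtain ⟨h, h'⟩ := hv <;> ext j <;> fin_cases j <;>
      simp [lineParam, mulVec, dotProduct, Fin.sum_univ_succ] <;> grind

theorem conicParam_left_inv (i : Fin 14) (x : Fin 3 → K) :
    (conicParam K i).2.1 *ᵥ ((conicParam K i).1 *ᵥ x) = (2 : K) • x := by
  fin_cases i <;> ext j <;> fin_cases j <;>
    simp [conicParam, mulVec, dotProduct, Fin.sum_univ_succ] <;> ring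

set_option maxHeartbeats 800000 in
theorem conicParam_right_inv (i : Fin 14) (v : Fin 4 → K) (hv : (conicVal v i).1 = 0) :
    (conicParam K i).1 *ᵥ ((conicParam K i).2.1 *ᵥ v) = (2 : K) • v := by
  fin_cases i <;> simp [conicVal] at hv <;> ext j <;> fin_cases j <;>
    simp [conicParam, mulVec, dotProduct, Fin.sum_univ_succ] <;> grind

set_option maxHeartbeats 800000 in
theorem conicVal_conicParam (i : Fin 14) (x : Fin 3 → K) :
    conicVal ((conicParam K i).1 *ᵥ x) i =
      (0, (conicParam K i).2.2 * (x 0 * x 2 - x 1 ^ 2)) := by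
  fin_cases i <;> simp [conicParam, conicVal, mulVec, dotProduct, Fin.sum_univ_succ] <;>
    first | ring1 | (constructor <;> ring1)

theorem isConic_conicCurve [CharZero K] (i : Fin 14) : IsConic (conicCurve K i) := by
  refine isConic_of_matrix ?_ (conicParam_left_inv i) (conicVal_conicParam i)
    (conicParam_right_inv i)
  fin_cases i <;> simp [conicParam]

end Curves

/-! ### The boundary of the open part of the quintic -/

section Complement

open MvPolynomial

variable {K : Type*} [Field K]

/-- The value of `W²F₃ - F₅` at `v = (W, X, Y, Z)`. -/
def quinticVal (v : Fin 4 → K) : K :=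
  v 0 ^ 2 * ((v 1 + v 2 + v 3) ^ 3 + (v 1 ^ 2 * v 3 + v 1 * v 2 ^ 2 + v 2 * v 3 ^ 2) +
    2 * v 1 * v 2 * v 3) - ((v 3 ^ 3 * v 1 ^ 2 + v 1 ^ 3 * v 2 ^ 2 + v 2 ^ 3 * v 3 ^ 2) -
    v 1 * v 2 * v 3 * (v 2 * v 3 + v 1 * v 2 + v 1 * v 3))

theorem eval_quintic (v : Fin 4 → K) : eval v (quintic K) = quinticVal v := by
  simp [quintic, F3, F5, quinticVal]

theorem mem_S6 {p : ℙ K (Fin 4 → K)} : p ∈ S6 K ↔ quinticVal p.rep = 0 := by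
  rw [← eval_quintic]
  rfl

theorem mk_mem_S6 {v : Fin 4 → K} (hv : v ≠ 0) :
    Projectivization.mk K v hv ∈ S6 K ↔ quinticVal v = 0 := by
  rw [← eval_quintic]
  exact mk_mem_projZeros (quintic_isHomogeneous K) hv

/-- The condition `W² + XY + YZ + XZ ≠ 0` with `W², X², Y², Z²` pairwise distinct. -/
def IsGeneric (v : Fin 4 → K) : Prop :=
  quadForm v ≠ 0 ∧ Function.Injective fun i => v i ^ 2

theorem not_isGeneric_iff {v : Fin 4 → K} :
    ¬ IsGeneric v ↔ quadForm v = 0 ∨ v 0 ^ 2 = v 1 ^ 2 ∨ v 0 ^ 2 = v 2 ^ 2 ∨ v 0 ^ 2 = v 3 ^ 2 ∨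
      v 1 ^ 2 = v 2 ^ 2 ∨ v 2 ^ 2 = v 3 ^ 2 ∨ v 1 ^ 2 = v 3 ^ 2 := by
  rw [← not_iff_not, not_not]
  push Not
  refine and_congr_right fun _ => ⟨fun h => ?_, ?_⟩
  · have h' {i j : Fin 4} (hij : i ≠ j) : v i ^ 2 ≠ v j ^ 2 := fun e => hij (h e)
    exact ⟨h' (by decide), h' (by decide), h' (by decide), h' (by decide), h' (by decide),
      h' (by decide)⟩
  · rintro ⟨h01, h02, h03, h12, h23, h13⟩ i j h
    fin_cases i <;> fin_cases j <;> simp_all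

theorem eval_boundaryPoly_eq_zero_iff {v : Fin 4 → K} :
    eval v (boundaryPoly K) = 0 ↔ ¬ IsGeneric v := by
  rw [not_isGeneric_iff]
  simp only [boundaryPoly, quadForm, map_mul, map_add, map_sub, map_pow, eval_X, mul_eq_zero,
    sub_eq_zero]
  tauto

/-- On each component of the boundary hypersurface the quintic equation splits into linear and
quadratic factors, each of which gives one of the curves. Since `W` enters the quintic only through
`W²`, the sign choices in `W² = X²` and its analogues give pairs of curves. -/
theorem exists_curve_of_not_isGeneric {v : Fin 4 → K} (h : quinticVal v = 0)
    (hv : ¬ IsGeneric v) : (∃ i, lineVal v i = 0) ∨ ∃ i, conicVal v i = 0 := by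
  have hl (i : Fin 9) {a b : K} (hi : lineVal v i = (a, b)) (ha : a = 0) (hb : b = 0) :
      (∃ i, lineVal v i = 0) ∨ ∃ i, conicVal v i = 0 :=
    Or.inl ⟨i, by rw [hi, ha, hb]; rfl⟩
  have hc (i : Fin 14) {a b : K} (hi : conicVal v i = (a, b)) (ha : a = 0) (hb : b = 0) :
      (∃ i, lineVal v i = 0) ∨ ∃ i, conicVal v i = 0 :=
    Or.inr ⟨i, by rw [hi, ha, hb]; rfl⟩
  unfold quinticVal at h
  rcases not_isGeneric_iff.1 hv with hQ | hW | hW | hW | hW | hW | hW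
  · unfold quadForm at hQ
    -- On the quadric `W² = -(XY + YZ + XZ)`, so `W` can be eliminated: with `e = XY + YZ + XZ` and
    -- `s = X + Y + Z`, one has `F₅ + eF₃ = (s² + e)(X + Y)(Y + Z)(Z + X)`.
    have : ((v 1 + v 2 + v 3) ^ 2 + (v 1 * v 2 + v 2 * v 3 + v 1 * v 3)) *
        (v 1 + v 2) * (v 2 + v 3) * (v 3 + v 1) = 0 := by
      linear_combination -h + hQ * ((v 1 + v 2 + v 3) ^ 3 + (v 1 ^ 2 * v 3 + v 1 * v 2 ^ 2 +
        v 2 * v 3 ^ 2) + 2 * v 1 * v 2 * v 3)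
    simp only [mul_eq_zero] at this
    rcases this with ((h1 | h1) | h1) | h1
    · rcases sq_eq_sq_iff_eq_or_eq_neg.1
        (show v 0 ^ 2 = (v 1 + v 2 + v 3) ^ 2 by linear_combination hQ - h1) with h0 | h0
      · exact hc 0 rfl (by linear_combination h0) (by linear_combination h1)
      · exact hc 1 rfl (by linear_combination h0) (by linear_combination h1)
    · rcases sq_eq_sq_iff_eq_or_eq_neg.1
        (show v 0 ^ 2 = v 1 ^ 2 by linear_combination hQ - (v 3 + v 1) * h1)
        with h0 | h0
      · exact hl 3 rfl (by linear_combination h0) (by linear_combination h0 + h1)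
      · exact hl 2 rfl (by linear_combination h0 - h1) (by linear_combination h0)
    · rcases sq_eq_sq_iff_eq_or_eq_neg.1
        (show v 0 ^ 2 = v 2 ^ 2 by linear_combination hQ - (v 1 + v 2) * h1) with h0 | h0
      · exact hl 1 rfl (by linear_combination h0) (by linear_combination h0 + h1)
      · exact hl 0 rfl (by linear_combination h0 - h1) (by linear_combination h0)
    · rcases sq_eq_sq_iff_eq_or_eq_neg.1
        (show v 0 ^ 2 = v 1 ^ 2 by linear_combination hQ - (v 1 + v 2) * h1) with h0 | h0
      · exact hl 4 rfl (by linear_combination h0) (by linear_combination h0 + h1)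
      · exact hl 5 rfl (by linear_combination h0 - h1) (by linear_combination h0)
  · rw [hW] at h
    have : (v 1 ^ 2 + v 1 * v 2 + 3 * v 1 * v 3 - v 2 * v 3) * (v 1 + v 2) ^ 2 * (v 1 + v 3) =
        0 := by linear_combination h
    simp only [mul_eq_zero, pow_eq_zero_iff two_ne_zero] at this
    rcases sq_eq_sq_iff_eq_or_eq_neg.1 hW with h0 | h0 <;> rcases this with (h1 | h1) | h1
    · exact hc 2 rfl (by linear_combination h0) h1
    · exact hl 3 rfl (by linear_combination h0) (by linear_combination h0 + h1)
    · exact hl 4 rfl (by linear_combination h0) (by linear_combination h0 + h1)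
    · exact hc 3 rfl (by linear_combination h0) h1
    · exact hl 2 rfl (by linear_combination h0 - h1) (by linear_combination h0)
    · exact hl 5 rfl (by linear_combination h0 - h1) (by linear_combination h0)
  · rw [hW] at h
    have : (v 2 ^ 2 + v 2 * v 3 + 3 * v 2 * v 1 - v 3 * v 1) * (v 2 + v 3) ^ 2 * (v 2 + v 1) =
        0 := by linear_combination h
    simp only [mul_eq_zero, pow_eq_zero_iff two_ne_zero] at this
    rcases sq_eq_sq_iff_eq_or_eq_neg.1 hW with h0 | h0 <;> rcases this with (h1 | h1) | h1
    · exact hc 4 rfl (by linear_combination h0) h1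
    · exact hl 1 rfl (by linear_combination h0) (by linear_combination h0 + h1)
    · exact hl 2 rfl (by linear_combination h0) (by linear_combination h0 + h1)
    · exact hc 5 rfl (by linear_combination h0) h1
    · exact hl 0 rfl (by linear_combination h0 - h1) (by linear_combination h0)
    · exact hl 3 rfl (by linear_combination h0 - h1) (by linear_combination h0)
  · rw [hW] at h
    have : (v 3 ^ 2 + v 3 * v 1 + 3 * v 3 * v 2 - v 1 * v 2) * (v 3 + v 1) ^ 2 * (v 3 + v 2) =
        0 := by linear_combination h
    simp only [mul_eq_zero, pow_eq_zero_iff two_ne_zero] at this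
    rcases sq_eq_sq_iff_eq_or_eq_neg.1 hW with h0 | h0 <;> rcases this with (h1 | h1) | h1
    · exact hc 6 rfl (by linear_combination h0) h1
    · exact hl 5 rfl (by linear_combination h0) (by linear_combination h0 + h1)
    · exact hl 0 rfl (by linear_combination h0) (by linear_combination h0 + h1)
    · exact hc 7 rfl (by linear_combination h0) h1
    · exact hl 4 rfl (by linear_combination h0 - h1) (by linear_combination h0)
    · exact hl 1 rfl (by linear_combination h0 - h1) (by linear_combination h0)
  · rcases sq_eq_sq_iff_eq_or_eq_neg.1 hW with h0 | h0 <;> rw [h0] at h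
    · have : (v 0 * (v 3 + 3 * v 2) + v 2 * (v 2 - v 3)) *
          (v 0 * (v 3 + 3 * v 2) - v 2 * (v 2 - v 3)) * (v 2 + v 3) = 0 := by
        linear_combination h
      simp only [mul_eq_zero] at this
      rcases this with (h1 | h1) | h1
      · exact hc 12 rfl (by linear_combination h0) h1
      · exact hc 13 rfl (by linear_combination h0) h1
      · exact hl 8 rfl (by linear_combination h0) (by linear_combination h0 + h1)
    -- Unlike the plane `X = Y`, the plane `X = -Y` cuts the quintic in lines only.
    · have : (v 0 - v 2) * (v 0 + v 2) * (v 3 + v 2) ^ 2 * (v 3 - v 2) = 0 := by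
        linear_combination h
      simp only [mul_eq_zero, pow_eq_zero_iff two_ne_zero] at this
      rcases this with ((h1 | h1) | h1) | h1
      · exact hl 2 rfl h1 (by linear_combination h0 + h1)
      · exact hl 3 rfl (by linear_combination h1 - h0) h1
      · exact hl 7 rfl (by linear_combination h0 - h1) (by linear_combination h0)
      · exact hl 6 rfl (by linear_combination - h1) (by linear_combination h0)
  · rcases sq_eq_sq_iff_eq_or_eq_neg.1 hW with h0 | h0 <;> rw [h0] at h
    · have : (v 0 * (v 1 + 3 * v 3) + v 3 * (v 3 - v 1)) *
          (v 0 * (v 1 + 3 * v 3) - v 3 * (v 3 - v 1)) * (v 3 + v 1) = 0 := by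
        linear_combination h
      simp only [mul_eq_zero] at this
      rcases this with (h1 | h1) | h1
      · exact hc 10 rfl (by linear_combination h0) h1
      · exact hc 11 rfl (by linear_combination h0) h1
      · exact hl 6 rfl (by linear_combination h0) (by linear_combination h0 + h1)
    · have : (v 0 - v 3) * (v 0 + v 3) * (v 1 + v 3) ^ 2 * (v 1 - v 3) = 0 := by
        linear_combination h
      simp only [mul_eq_zero, pow_eq_zero_iff two_ne_zero] at this
      rcases this with ((h1 | h1) | h1) | h1
      · exact hl 0 rfl h1 (by linear_combination h0 + h1)
      · exact hl 1 rfl (by linear_combination h1 - h0) h1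
      · exact hl 8 rfl (by linear_combination h1 - h0) h1
      · exact hl 7 rfl h1 (by linear_combination h0 + h1)
  · rcases sq_eq_sq_iff_eq_or_eq_neg.1 hW with h0 | h0 <;> rw [h0] at h
    · have : (v 0 * (v 2 + 3 * v 1) + v 1 * (v 1 - v 2)) *
          (v 0 * (v 2 + 3 * v 1) - v 1 * (v 1 - v 2)) * (v 1 + v 2) = 0 := by
        rw [h0]
        linear_combination h
      simp only [mul_eq_zero] at this
      rcases this with (h1 | h1) | h1
      · exact hc 8 rfl (by linear_combination -h0) h1
      · exact hc 9 rfl (by linear_combination -h0) h1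
      · exact hl 7 rfl (by linear_combination h0) h1
    · have : (v 0 - v 3) * (v 0 + v 3) * (v 2 - v 3) ^ 2 * (v 2 + v 3) = 0 := by
        linear_combination h
      simp only [mul_eq_zero, pow_eq_zero_iff two_ne_zero] at this
      rcases this with ((h1 | h1) | h1) | h1
      · exact hl 5 rfl h1 (by linear_combination h0 + h1)
      · exact hl 4 rfl (by linear_combination h1 - h0) h1
      · exact hl 6 rfl h1 (by linear_combination h0 + h1)
      · exact hl 8 rfl (by linear_combination h0 - h1) (by linear_combination h0)

theorem quinticVal_eq_zero_of_lineVal {v : Fin 4 → K} {i : Fin 9} (h : lineVal v i = 0) :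
    quinticVal v = 0 ∧ ¬ IsGeneric v := by
  rw [not_isGeneric_iff]
  unfold quinticVal
  fin_cases i <;> obtain ⟨h1, h2⟩ := Prod.mk_eq_zero.1 h
  · obtain ⟨e1, e2⟩ : v 3 = v 0 ∧ v 2 = - v 0 :=
      ⟨by linear_combination -h1, by linear_combination h2⟩
    exact ⟨by rw [e1, e2]; ring,
      Or.inr <| Or.inr <| Or.inr <| Or.inl (by rw [e1])⟩
  · obtain ⟨e1, e2⟩ : v 2 = v 0 ∧ v 3 = - v 0 :=
      ⟨by linear_combination -h1, by linear_combination h2⟩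
    exact ⟨by rw [e1, e2]; ring,
      Or.inr <| Or.inr <| Or.inl (by rw [e1])⟩
  · obtain ⟨e1, e2⟩ : v 2 = v 0 ∧ v 1 = - v 0 :=
      ⟨by linear_combination -h1, by linear_combination h2⟩
    exact ⟨by rw [e1, e2]; ring,
      Or.inr <| Or.inr <| Or.inl (by rw [e1])⟩
  · obtain ⟨e1, e2⟩ : v 1 = v 0 ∧ v 2 = - v 0 :=
      ⟨by linear_combination -h1, by linear_combination h2⟩
    exact ⟨by rw [e1, e2]; ring,
      Or.inr <| Or.inl (by rw [e1])⟩
  · obtain ⟨e1, e2⟩ : v 1 = v 0 ∧ v 3 = - v 0 :=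
      ⟨by linear_combination -h1, by linear_combination h2⟩
    exact ⟨by rw [e1, e2]; ring,
      Or.inr <| Or.inl (by rw [e1])⟩
  · obtain ⟨e1, e2⟩ : v 3 = v 0 ∧ v 1 = - v 0 :=
      ⟨by linear_combination -h1, by linear_combination h2⟩
    exact ⟨by rw [e1, e2]; ring,
      Or.inr <| Or.inr <| Or.inr <| Or.inl (by rw [e1])⟩
  · obtain ⟨e1, e2⟩ : v 3 = v 2 ∧ v 1 = - v 2 :=
      ⟨by linear_combination -h1, by linear_combination h2⟩
    exact ⟨by rw [e1, e2]; ring,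
      Or.inr <| Or.inr <| Or.inr <| Or.inr <| Or.inr <| Or.inl (by rw [e1])⟩
  · obtain ⟨e1, e2⟩ : v 3 = v 1 ∧ v 2 = - v 1 :=
      ⟨by linear_combination -h1, by linear_combination h2⟩
    exact ⟨by rw [e1, e2]; ring,
      Or.inr <| Or.inr <| Or.inr <| Or.inr <| Or.inr <| Or.inr <| (by rw [e1])⟩
  · obtain ⟨e1, e2⟩ : v 2 = v 1 ∧ v 3 = - v 1 :=
      ⟨by linear_combination -h1, by linear_combination h2⟩
    exact ⟨by rw [e1, e2]; ring,
      Or.inr <| Or.inr <| Or.inr <| Or.inr <| Or.inl (by rw [e1])⟩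

theorem quinticVal_eq_zero_of_conicVal {v : Fin 4 → K} {i : Fin 14} (h : conicVal v i = 0) :
    quinticVal v = 0 ∧ ¬ IsGeneric v := by
  rw [not_isGeneric_iff]
  unfold quinticVal
  fin_cases i <;> obtain ⟨h1, h2⟩ := Prod.mk_eq_zero.1 h
  -- The identity for `F₅ + eF₃` on the quadric gives the cofactor: when `W² = s²`, the quintic
  -- equals `(s² + e)(F₃ - (X + Y)(Y + Z)(Z + X))`, and `s² + e` is the equation of the conic.
  · have e : v 0 = (v 1 + v 2 + v 3) := by linear_combination h1
    exact ⟨by rw [e]; linear_combination (((v 1 + v 2 + v 3) ^ 3 + (v 1 ^ 2 * v 3 + v 1 * v 2 ^ 2 +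
        v 2 * v 3 ^ 2) + 2 * v 1 * v 2 * v 3 - (v 1 + v 2) * (v 2 + v 3) * (v 3 + v 1))) * h2,
      Or.inl (by rw [quadForm, e]; linear_combination h2)⟩
  · have e : v 0 = -(v 1 + v 2 + v 3) := by linear_combination h1
    exact ⟨by rw [e]; linear_combination (((v 1 + v 2 + v 3) ^ 3 + (v 1 ^ 2 * v 3 + v 1 * v 2 ^ 2 +
        v 2 * v 3 ^ 2) + 2 * v 1 * v 2 * v 3 - (v 1 + v 2) * (v 2 + v 3) * (v 3 + v 1))) * h2,
      Or.inl (by rw [quadForm, e]; linear_combination h2)⟩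
  · have e : v 0 = v 1 := by linear_combination h1
    exact ⟨by rw [e]; linear_combination ((v 1 + v 2) ^ 2 * (v 1 + v 3)) * h2,
      Or.inr <| Or.inl (by rw [e])⟩
  · have e : v 0 = -v 1 := by linear_combination h1
    exact ⟨by rw [e]; linear_combination ((v 1 + v 2) ^ 2 * (v 1 + v 3)) * h2,
      Or.inr <| Or.inl (by rw [e, neg_sq])⟩
  · have e : v 0 = v 2 := by linear_combination h1
    exact ⟨by rw [e]; linear_combination ((v 2 + v 3) ^ 2 * (v 2 + v 1)) * h2,
      Or.inr <| Or.inr <| Or.inl (by rw [e])⟩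
  · have e : v 0 = -v 2 := by linear_combination h1
    exact ⟨by rw [e]; linear_combination ((v 2 + v 3) ^ 2 * (v 2 + v 1)) * h2,
      Or.inr <| Or.inr <| Or.inl (by rw [e, neg_sq])⟩
  · have e : v 0 = v 3 := by linear_combination h1
    exact ⟨by rw [e]; linear_combination ((v 3 + v 1) ^ 2 * (v 3 + v 2)) * h2,
      Or.inr <| Or.inr <| Or.inr <| Or.inl (by rw [e])⟩
  · have e : v 0 = -v 3 := by linear_combination h1
    exact ⟨by rw [e]; linear_combination ((v 3 + v 1) ^ 2 * (v 3 + v 2)) * h2,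
      Or.inr <| Or.inr <| Or.inr <| Or.inl (by rw [e, neg_sq])⟩
  · have e : v 3 = v 1 := by linear_combination h1
    exact ⟨by
        rw [e]
        linear_combination ((v 0 * (v 2 + 3 * v 1) - v 1 * (v 1 - v 2)) * (v 1 + v 2)) * h2,
      Or.inr <| Or.inr <| Or.inr <| Or.inr <| Or.inr <| Or.inr <| (by rw [e])⟩
  · have e : v 3 = v 1 := by linear_combination h1
    exact ⟨by
        rw [e]
        linear_combination ((v 0 * (v 2 + 3 * v 1) + v 1 * (v 1 - v 2)) * (v 1 + v 2)) * h2,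
      Or.inr <| Or.inr <| Or.inr <| Or.inr <| Or.inr <| Or.inr <| (by rw [e])⟩
  · have e : v 2 = v 3 := by linear_combination h1
    exact ⟨by
        rw [e]
        linear_combination ((v 0 * (v 1 + 3 * v 3) - v 3 * (v 3 - v 1)) * (v 3 + v 1)) * h2,
      Or.inr <| Or.inr <| Or.inr <| Or.inr <| Or.inr <| Or.inl (by rw [e])⟩
  · have e : v 2 = v 3 := by linear_combination h1
    exact ⟨by
        rw [e]
        linear_combination ((v 0 * (v 1 + 3 * v 3) + v 3 * (v 3 - v 1)) * (v 3 + v 1)) * h2,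
      Or.inr <| Or.inr <| Or.inr <| Or.inr <| Or.inr <| Or.inl (by rw [e])⟩
  · have e : v 1 = v 2 := by linear_combination h1
    exact ⟨by
        rw [e]
        linear_combination ((v 0 * (v 3 + 3 * v 2) - v 2 * (v 2 - v 3)) * (v 2 + v 3)) * h2,
      Or.inr <| Or.inr <| Or.inr <| Or.inr <| Or.inl (by rw [e])⟩
  · have e : v 1 = v 2 := by linear_combination h1
    exact ⟨by
        rw [e]
        linear_combination ((v 0 * (v 3 + 3 * v 2) + v 2 * (v 2 - v 3)) * (v 2 + v 3)) * h2,
      Or.inr <| Or.inr <| Or.inr <| Or.inr <| Or.inl (by rw [e])⟩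

theorem S6_inter_boundary : S6 K ∩ projZeros (boundaryPoly K) =
    (⋃ i, lineCurve K i) ∪ ⋃ i, conicCurve K i := by
  ext p
  simp only [Set.mem_inter_iff, Set.mem_union, Set.mem_iUnion, mem_S6, mem_lineCurve,
    mem_conicCurve]
  change _ ∧ eval _ _ = 0 ↔ _
  rw [eval_boundaryPoly_eq_zero_iff]
  constructor
  · exact fun h => exists_curve_of_not_isGeneric h.1 h.2
  · rintro (⟨i, hi⟩ | ⟨i, hi⟩)
    · exact quinticVal_eq_zero_of_lineVal hi
    · exact quinticVal_eq_zero_of_conicVal hi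

end Complement

/-! ### The rational map `φ` and its inverse as maps of points -/

section Birational

variable {K : Type*} [Field K]

theorem phi_apply_zero (t : Fin 3 → K) : phi t 0 = -t 1 + t 2 - t 1 * t 2 + t 0 * t 1 := rfl

theorem phi_apply_one (t : Fin 3 → K) :
    phi t 1 = -t 1 - t 2 + t 1 * t 2 + 2 * t 0 - t 0 * t 1 := rfl

theorem phi_apply_two (t : Fin 3 → K) : phi t 2 = t 1 - t 2 - t 1 * t 2 + t 0 * t 1 := rfl

theorem phi_apply_three (t : Fin 3 → K) : phi t 3 = t 1 + t 2 - t 0 * t 1 - t 1 * t 2 := rfl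

theorem quadForm_phi (t : Fin 3 → K) :
    quadForm (phi t) = 4 * (t 1 * (1 - t 1) * (t 0 - t 2)) := by
  simp only [quadForm, phi_apply_zero, phi_apply_one, phi_apply_two, phi_apply_three]
  ring

theorem quadForm_smul (c : K) (v : Fin 4 → K) : quadForm (c • v) = c ^ 2 * quadForm v := by
  simp only [quadForm, Pi.smul_apply, smul_eq_mul]
  ring

/-- The open cone over `projDomain`. -/
def coneDomain (K : Type*) [Field K] : Set (Fin 4 → K) :=
  {v | quadForm v * (v 1 + v 2) * (v 0 + v 2) * (v 0 - v 1) ≠ 0}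

theorem smul_mem_coneDomain {c : K} (hc : c ≠ 0) {v : Fin 4 → K} :
    c • v ∈ coneDomain K ↔ v ∈ coneDomain K := by
  have : quadForm (c • v) * ((c • v) 1 + (c • v) 2) * ((c • v) 0 + (c • v) 2) *
      ((c • v) 0 - (c • v) 1) =
      c ^ 5 * (quadForm v * (v 1 + v 2) * (v 0 + v 2) * (v 0 - v 1)) := by
    rw [quadForm_smul]
    simp only [Pi.smul_apply, smul_eq_mul]
    ring
  change _ ≠ 0 ↔ _ ≠ 0
  rw [this]
  simp [hc]

theorem mk_mem_projDomain {v : Fin 4 → K} (hv : v ≠ 0) :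
    Projectivization.mk K v hv ∈ projDomain K ↔ v ∈ coneDomain K := by
  obtain ⟨c, hc⟩ := Projectivization.exists_smul_eq_mk_rep K v hv
  change Projectivization.rep _ ∈ coneDomain K ↔ _
  rw [← hc, Units.smul_def, smul_mem_coneDomain c.ne_zero]

theorem coneDomain_ne_zero {v : Fin 4 → K} (hv : v ∈ coneDomain K) : v ≠ 0 := by
  rintro rfl
  simp [coneDomain] at hv

/-- All three coordinates are homogeneous of degree zero, so `psi` descends to projective space. -/
theorem psi_smul {c : K} (hc : c ≠ 0) (v : Fin 4 → K) : psi (c • v) = psi v := by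
  simp only [psi, quadForm_smul, Pi.smul_apply, smul_eq_mul]
  have h1 : (c * v 1 + c * v 3) * (c * v 0 + c * v 2) / (c ^ 2 * quadForm v) =
      (v 1 + v 3) * (v 0 + v 2) / quadForm v := by
    rw [← mul_div_mul_left _ (quadForm v) (pow_ne_zero 2 hc)]
    ring
  have h2 : (c * v 0 + c * v 2) / (c * v 1 + c * v 2) = (v 0 + v 2) / (v 1 + v 2) := by
    rw [← mul_add, ← mul_add, mul_div_mul_left _ _ hc]
  have h3 : (c * v 0 + c * v 3) * (c * v 0 + c * v 2) / (c ^ 2 * quadForm v) =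
      (v 0 + v 3) * (v 0 + v 2) / quadForm v := by
    rw [← mul_div_mul_left _ (quadForm v) (pow_ne_zero 2 hc)]
    ring
  rw [h1, h2, h3]

theorem psi_rep_mk {v : Fin 4 → K} (hv : v ≠ 0) :
    psi (Projectivization.mk K v hv).rep = psi v := by
  obtain ⟨c, hc⟩ := Projectivization.exists_smul_eq_mk_rep K v hv
  rw [← hc, Units.smul_def, psi_smul c.ne_zero]

theorem psi_mem_affineDomain {v : Fin 4 → K} (hv : v ∈ coneDomain K) :
    psi v ∈ affineDomain K := by
  simp only [coneDomain, Set.mem_ofPred_eq, ne_eq, mul_eq_zero, not_or] at hv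
  obtain ⟨⟨⟨hQ, h12⟩, h02⟩, h01⟩ := hv
  have e : psi v 1 * (psi v 1 - 1) * (psi v 0 - psi v 2) =
      -((v 0 + v 2) ^ 2 * (v 0 - v 1) ^ 2 / ((v 1 + v 2) ^ 2 * quadForm v)) := by
    simp only [psi, Matrix.cons_val]
    field_simp
    ring
  change _ ≠ 0
  rw [e]
  exact neg_ne_zero.2 (div_ne_zero (mul_ne_zero (pow_ne_zero 2 h02) (pow_ne_zero 2 h01))
    (mul_ne_zero (pow_ne_zero 2 h12) hQ))

theorem phi_psi {v : Fin 4 → K} (hv : v ∈ coneDomain K) :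
    phi (psi v) = (2 * (v 1 - v 0) * (v 0 + v 2) / (quadForm v * (v 1 + v 2))) • v := by
  simp only [coneDomain, Set.mem_ofPred_eq, ne_eq, mul_eq_zero, not_or] at hv
  obtain ⟨⟨⟨hQ, h12⟩, h02⟩, h01⟩ := hv
  ext i
  fin_cases i <;> simp only [phi, psi, Pi.smul_apply, smul_eq_mul, Matrix.cons_val, Fin.mk_one,
    Fin.zero_eta, Fin.reduceFinMk] <;> field_simp <;> simp only [quadForm] <;> ring

variable [CharZero K]

/-- The forms `X + Y`, `W + Y`, `W - X` and the quadratic form all pull back to constants times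
products of `y`, `y - 1` and `x - z`. The constants are powers of `2` up to sign, which is where the
characteristic enters. -/
theorem phi_mem_coneDomain {t : Fin 3 → K} (ht : t ∈ affineDomain K) : phi t ∈ coneDomain K := by
  simp only [affineDomain, Set.mem_ofPred_eq, ne_eq, mul_eq_zero, not_or] at ht
  obtain ⟨⟨h1, h1'⟩, h02⟩ := ht
  have e : quadForm (phi t) * (phi t 1 + phi t 2) * (phi t 0 + phi t 2) * (phi t 0 - phi t 1) =
      -(32 * (t 1 ^ 2 * (t 1 - 1) ^ 2 * (t 0 - t 2) ^ 4)) := by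
    rw [quadForm_phi]
    simp only [phi_apply_zero, phi_apply_one, phi_apply_two]
    ring
  change _ ≠ 0
  rw [e]
  simp [h1, h1', h02]

theorem phi_ne_zero {t : Fin 3 → K} (ht : t ∈ affineDomain K) : phi t ≠ 0 :=
  coneDomain_ne_zero (phi_mem_coneDomain ht)

theorem psi_phi {t : Fin 3 → K} (ht : t ∈ affineDomain K) : psi (phi t) = t := by
  simp only [affineDomain, Set.mem_ofPred_eq, ne_eq, mul_eq_zero, not_or] at ht
  obtain ⟨⟨h1, h1'⟩, h02⟩ := ht
  have h1'' : 1 - t 1 ≠ 0 := fun h => h1' (by linear_combination -h)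
  have e13 : phi t 1 + phi t 3 = 2 * (t 0 * (1 - t 1)) := by
    simp only [phi_apply_one, phi_apply_three]; ring
  have e02 : phi t 0 + phi t 2 = 2 * (t 1 * (t 0 - t 2)) := by
    simp only [phi_apply_zero, phi_apply_two]; ring
  have e12 : phi t 1 + phi t 2 = 2 * (t 0 - t 2) := by
    simp only [phi_apply_one, phi_apply_two]; ring
  have e03 : phi t 0 + phi t 3 = 2 * (t 2 * (1 - t 1)) := by
    simp only [phi_apply_zero, phi_apply_three]; ring
  ext i
  fin_cases i <;> simp only [psi, quadForm_phi, Matrix.cons_val, Fin.mk_one,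
    Fin.zero_eta, Fin.reduceFinMk, e13, e02, e12, e03] <;> field_simp <;> ring

theorem mk_phi_psi {v : Fin 4 → K} (hv : v ∈ coneDomain K) :
    Projectivization.mk K (phi (psi v)) (phi_ne_zero (psi_mem_affineDomain hv)) =
      Projectivization.mk K v (coneDomain_ne_zero hv) := by
  rw [Projectivization.mk_eq_mk_iff']
  exact ⟨_, (phi_psi hv).symm⟩

/-- The bijection given by `φ` and `ψ`. -/
def phiEquiv (K : Type*) [Field K] [CharZero K] : affineDomain K ≃ projDomain K where
  toFun t := ⟨Projectivization.mk K (phi t.1) (phi_ne_zero t.2),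
    (mk_mem_projDomain _).2 (phi_mem_coneDomain t.2)⟩
  invFun p := ⟨psi p.1.rep, psi_mem_affineDomain p.2⟩
  left_inv t := Subtype.ext ((psi_rep_mk _).trans (psi_phi t.2))
  right_inv p := Subtype.ext (by
    have := mk_phi_psi (v := p.1.rep) p.2
    rw [Projectivization.mk_rep] at this
    exact this)

end Birational

/-! ### Regularity of `φ` and its inverse -/

section BirationalIso

open FunSpace

variable (k : Type*) {K : Type*} [Field k] [Field K] [Algebra k K]

theorem isGood_projSpace (n : ℕ) : IsGood k (projSpace k K n) :=
  ((isGood_affineSpace k K (Fin n)).induced _).quotient _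

variable {k}

theorem regular_natCast {X : Type*} {A : FunSpace K X} (hA : IsGood k A) (n : ℕ) :
    A.regular Set.univ fun _ => (n : K) := by
  simpa using hA.const Set.univ (n : k)

theorem regular_phi {X : Type*} {A : FunSpace K X} (hA : IsGood k A) {t : X → Fin 3 → K}
    (ht : ∀ i, A.regular Set.univ fun x => t x i) (i : Fin 4) :
    A.regular Set.univ fun x => phi (t x) i := by
  have h01 := hA.mul (ht 0) (ht 1)
  have h12 := hA.mul (ht 1) (ht 2)
  fin_cases i
  · exact hA.add (hA.sub (hA.add (hA.neg (ht 1)) (ht 2)) h12) h01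
  · exact hA.sub (hA.add (hA.add (hA.sub (hA.neg (ht 1)) (ht 2)) h12)
      (hA.mul (regular_natCast hA 2) (ht 0))) h01
  · exact hA.add (hA.sub (hA.sub (ht 1) (ht 2)) h12) h01
  · exact hA.sub (hA.sub (hA.add (ht 1) (ht 2)) h01) h12

/-- A map to projective space given by regular homogeneous coordinates is a morphism. -/
theorem Hom.into_projSpace {X : Type*} {A : FunSpace K X} (hA : IsGood k A) {n : ℕ}
    {f : X → Fin n → K} (h0 : ∀ x, f x ≠ 0) (hf : ∀ i, A.regular Set.univ fun x => f x i) :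
    Hom A (projSpace k K n) fun x => Projectivization.mk K (f x) (h0 x) := by
  have h := Hom.into_affineSpace hA hf
  have h' : Hom A ((affineSpace k K (Fin n)).induced
      (Subtype.val : {v : Fin n → K // v ≠ 0} → (Fin n → K))) fun x => ⟨f x, h0 x⟩ :=
    Hom.into_induced hA h
  exact (hom_quotient _ _).comp h'

/-- Checked on the cone over the domain: there the coordinates of `psi` are quotients of
polynomials, with denominators `quadForm` and `X + Y` that do not vanish. -/
theorem hom_psi : Hom ((projSpace k K 4).induced (Subtype.val : projDomain K → _))
    (affineSpace k K (Fin 3)) fun p => psi p.1.rep := by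
  have hA := (isGood_affineSpace k K (Fin 4)).induced
    (Subtype.val : {v : Fin 4 → K // v ≠ 0} → (Fin 4 → K))
  have hc (i : Fin 4) := (hom_induced (affineSpace k K (Fin 4))
    (Subtype.val : {v : Fin 4 → K // v ≠ 0} → (Fin 4 → K))).regular_coord i
  have hQ := hA.add (hA.add (hA.add (hA.pow (hc 0) 2) (hA.mul (hc 1) (hc 2)))
    (hA.mul (hc 2) (hc 3))) (hA.mul (hc 1) (hc 3))
  have hS := hA.isOpen_ne (isOpen_univ _) (hA.mul (hA.mul (hA.mul hQ (hA.add (hc 1) (hc 2)))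
    (hA.add (hc 0) (hc 2))) (hA.sub (hc 0) (hc 1)))
  have hmem (v : {v : Fin 4 → K // v ≠ 0}) :
      Projectivization.mk' K v ∈ projDomain K ↔ v.1 ∈ coneDomain K := mk_mem_projDomain v.2
  refine Hom.of_comp_quotient_restrict hA ?_ ?_
  · convert hS using 1
    ext v
    exact (hmem v).trans (by simp [coneDomain, quadForm])
  · have hB := hA.induced (Subtype.val : Projectivization.mk' K ⁻¹' projDomain K → _)
    have hc (i : Fin 4) := (hom_induced _
      (Subtype.val : Projectivization.mk' K ⁻¹' projDomain K → _)).regular (hc i)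
    have hQ := (hom_induced _
      (Subtype.val : Projectivization.mk' K ⁻¹' projDomain K → _)).regular hQ
    have hne (v : (Projectivization.mk' K ⁻¹' projDomain K : Set {v : Fin 4 → K // v ≠ 0})) :
        quadForm v.1.1 ≠ 0 ∧ v.1.1 1 + v.1.1 2 ≠ 0 := by
      have := (hmem v.1).1 v.2
      simp only [coneDomain, Set.mem_ofPred_eq, ne_eq, mul_eq_zero, not_or] at this
      exact ⟨this.1.1.1, this.1.1.2⟩
    have e (v : (Projectivization.mk' K ⁻¹' projDomain K : Set {v : Fin 4 → K // v ≠ 0})) :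
        psi (Projectivization.mk' K v.1).rep = psi v.1.1 := psi_rep_mk v.1.2
    refine Hom.into_affineSpace hB fun i => ?_
    simp only [e]
    fin_cases i
    · exact hB.div (hB.mul (hB.add (hc 1) (hc 3)) (hB.add (hc 0) (hc 2))) hQ fun v _ => (hne v).1
    · exact hB.div (hB.add (hc 0) (hc 2)) (hB.add (hc 1) (hc 2)) fun v _ => (hne v).2
    · exact hB.div (hB.mul (hB.add (hc 0) (hc 3)) (hB.add (hc 0) (hc 2))) hQ fun v _ => (hne v).1

variable (k K) in
theorem phiEquiv_isIso [CharZero K] :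
    IsIso ((affineSpace k K (Fin 3)).induced Subtype.val)
      ((projSpace k K 4).induced Subtype.val) (phiEquiv K) := by
  have hA := (isGood_affineSpace k K (Fin 3)).induced (Subtype.val : affineDomain K → _)
  have hB := (isGood_projSpace k (K := K) 4).induced (Subtype.val : projDomain K → _)
  exact isIso_of_hom
    (Hom.into_induced hA (Hom.into_projSpace hA (fun t => phi_ne_zero t.2)
      (regular_phi hA (hom_induced _ _).regular_coord)))
    (Hom.into_induced hB hom_psi)

end BirationalIso

/-! ### The endomorphism with a given normal cycle -/

section NormalForm

variable {K : Type*} [Field K]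

/-- The determinant of two vectors of the plane. -/
def br (p q : Fin 2 → K) : K := p 0 * q 1 - p 1 * q 0

theorem mk_eq_mk_iff_br {p q : Fin 2 → K} (hp : p ≠ 0) (hq : q ≠ 0) :
    Projectivization.mk K p hp = Projectivization.mk K q hq ↔ br p q = 0 := by
  rw [Projectivization.mk_eq_mk_iff', br]
  constructor
  · rintro ⟨a, rfl⟩
    simp only [Pi.smul_apply, smul_eq_mul]
    ring
  · intro h
    by_cases h0 : q 0 = 0
    · have h1 : q 1 ≠ 0 := by
        contrapose! hq
        ext i
        fin_cases i <;> simp [h0, hq]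
      have hp0 : p 0 = 0 := by simpa [h0, h1] using h
      refine ⟨p 1 / q 1, ?_⟩
      ext i
      fin_cases i <;> simp [h0, hp0, h1]
    · refine ⟨p 0 / q 0, ?_⟩
      ext i
      fin_cases i
      · simp [h0]
      · simp only [Fin.mk_one, Pi.smul_apply, smul_eq_mul]
        field_simp
        linear_combination h

theorem quadMap_smul_smul (c d : K) (a : Fin 6 → K) (v : Fin 2 → K) :
    quadMap (c • a) (d • v) = (c * d ^ 2) • quadMap a v := by
  ext i
  fin_cases i <;> simp [quadMap] <;> ring

theorem mk_mem_End2 {a : Fin 6 → K} (ha : a ≠ 0) :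
    Projectivization.mk K a ha ∈ End2 K ↔ ∀ x : Fin 2 → K, x ≠ 0 → quadMap a x ≠ 0 := by
  obtain ⟨c, hc⟩ := Projectivization.exists_smul_eq_mk_rep K a ha
  change (∀ x : Fin 2 → K, x ≠ 0 → quadMap (Projectivization.rep _) x ≠ 0) ↔ _
  refine forall₂_congr fun x _ => ?_
  have := quadMap_smul_smul (c : K) 1 a x
  rw [one_smul] at this
  rw [← hc, Units.smul_def, this]
  simp

theorem End2.app_mk (f : End2 K) {a : Fin 6 → K} (ha : a ≠ 0)
    (hf : f.1 = Projectivization.mk K a ha)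
    {v : Fin 2 → K} (hv : v ≠ 0) (h : quadMap a v ≠ 0) :
    End2.app f (Projectivization.mk K v hv) = Projectivization.mk K (quadMap a v) h := by
  obtain ⟨c, hc⟩ := Projectivization.exists_smul_eq_mk_rep K a ha
  obtain ⟨d, hd⟩ := Projectivization.exists_smul_eq_mk_rep K v hv
  rw [End2.app, Projectivization.mk_eq_mk_iff']
  refine ⟨c * d ^ 2, ?_⟩
  rw [hf, ← hc, ← hd, Units.smul_def, Units.smul_def, quadMap_smul_smul]

theorem mk_mem_MTilde {a : Fin 6 → K} (ha : a ≠ 0) {p : Fin 6 → Fin 2 → K} (hp : ∀ i, p i ≠ 0) :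
    ((Projectivization.mk K a ha, fun i => Projectivization.mk K (p i) (hp i)) :
      ℙ K (Fin 6 → K) × (Fin 6 → ℙ K (Fin 2 → K))) ∈ MTilde K ↔
      (∀ i j, i ≠ j → br (p i) (p j) ≠ 0) ∧ (∀ x : Fin 2 → K, x ≠ 0 → quadMap a x ≠ 0) ∧
        ∀ i, br (quadMap a (p i)) (p (i + 1)) = 0 := by
  refine and_congr ?_ ⟨?_, ?_⟩
  · refine ⟨fun h i j hij h' => hij (h ((mk_eq_mk_iff_br _ _).2 h')), fun h i j hij => ?_⟩
    by_contra hne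
    exact h i j hne ((mk_eq_mk_iff_br _ _).1 hij)
  · rintro ⟨h, h'⟩
    have hq := (mk_mem_End2 ha).1 h
    refine ⟨hq, fun i => ?_⟩
    rw [← mk_eq_mk_iff_br (hq _ (hp i)) (hp _), ← End2.app_mk ⟨_, h⟩ ha rfl (hp i)]
    exact h' i
  · rintro ⟨h, h'⟩
    refine ⟨(mk_mem_End2 ha).2 h, fun i => ?_⟩
    dsimp only
    rw [End2.app_mk _ ha rfl (hp i) (h _ (hp i)), mk_eq_mk_iff_br, h' i]

/-- The vectors `(0,1), (1,0), (1,1), (x,1), (y,1), (z,1)`. -/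
def normalVec (t : Fin 3 → K) : Fin 6 → Fin 2 → K :=
  ![![0, 1], ![1, 0], ![1, 1], ![t 0, 1], ![t 1, 1], ![t 2, 1]]

theorem normalVec_ne_zero (t : Fin 3 → K) (i : Fin 6) : normalVec t i ≠ 0 := by
  intro h
  have h0 := congrFun h 0
  have h1 := congrFun h 1
  fin_cases i <;> simp [normalVec] at h0 h1

theorem normalCycle_eq (t : Fin 3 → K) :
    normalCycle t = fun i => Projectivization.mk K (normalVec t i) (normalVec_ne_zero t i) := rfl

/-- `(X - Z) / 2`. -/
def halfXZ (t : Fin 3 → K) : K := t 0 - t 1 - t 2 + t 1 * t 2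

/-- `(Y - Z) / 2`. -/
def halfYZ (t : Fin 3 → K) : K := t 0 * t 1 - t 2

/-- `(X - Y) / 2`. -/
def halfXY (t : Fin 3 → K) : K := t 0 - t 1 + t 1 * t 2 - t 0 * t 1

/-- The points of a normal cycle are distinct, and `X, Y, Z` are distinct. -/
structure CycleGeneric (t : Fin 3 → K) : Prop where
  x0 : t 0 ≠ 0
  y0 : t 1 ≠ 0
  z0 : t 2 ≠ 0
  x1 : t 0 - 1 ≠ 0
  y1 : t 1 - 1 ≠ 0
  z1 : t 2 - 1 ≠ 0
  xy : t 0 - t 1 ≠ 0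
  xz : t 0 - t 2 ≠ 0
  yz : t 1 - t 2 ≠ 0
  hXZ : halfXZ t ≠ 0
  hYZ : halfYZ t ≠ 0
  hXY : halfXY t ≠ 0

theorem CycleGeneric.mem_affineDomain {t : Fin 3 → K} (h : CycleGeneric t) : t ∈ affineDomain K :=
  mul_ne_zero (mul_ne_zero h.y0 h.y1) h.xz

/-- For each pair of coordinates of `φ(x, y, z)`, both the sum and the difference factor. The
factors are differences of the points of the cycle and the three quantities `halfXZ`, `halfYZ`,
`halfXY`, and every one of them occurs. -/
theorem isGeneric_phi_iff [CharZero K] (t : Fin 3 → K) : IsGeneric (phi t) ↔ CycleGeneric t := by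
  have h01 : phi t 0 ^ 2 - phi t 1 ^ 2 = 4 * ((t 0 - t 2) * (t 1 - 1) * (t 0 - t 1)) := by
    simp only [phi_apply_zero, phi_apply_one]; ring
  have h02 : phi t 0 ^ 2 - phi t 2 ^ 2 = -4 * ((t 1 - t 2) * t 1 * (t 0 - t 2)) := by
    simp only [phi_apply_zero, phi_apply_two]; ring
  have h03 : phi t 0 ^ 2 - phi t 3 ^ 2 = -4 * (t 1 * (t 0 - 1) * t 2 * (t 1 - 1)) := by
    simp only [phi_apply_zero, phi_apply_three]; ring
  have h12 : phi t 1 ^ 2 - phi t 2 ^ 2 = 4 * ((t 0 - t 2) * halfXY t) := by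
    simp only [phi_apply_one, phi_apply_two, halfXY]; ring
  have h23 : phi t 2 ^ 2 - phi t 3 ^ 2 = -4 * (t 1 * (t 2 - 1) * halfYZ t) := by
    simp only [phi_apply_two, phi_apply_three, halfYZ]; ring
  have h13 : phi t 1 ^ 2 - phi t 3 ^ 2 = -4 * (t 0 * (t 1 - 1) * halfXZ t) := by
    simp only [phi_apply_one, phi_apply_three, halfXZ]; ring
  have hQ : quadForm (phi t) = -4 * (t 1 * (t 1 - 1) * (t 0 - t 2)) := by
    rw [quadForm_phi]; ring
  rw [← not_iff_not, not_isGeneric_iff, ← sub_eq_zero (b := phi t 1 ^ 2),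
    ← sub_eq_zero (a := phi t 0 ^ 2) (b := phi t 2 ^ 2), ← sub_eq_zero (a := phi t 0 ^ 2)
    (b := phi t 3 ^ 2), ← sub_eq_zero (a := phi t 1 ^ 2) (b := phi t 2 ^ 2),
    ← sub_eq_zero (a := phi t 2 ^ 2), ← sub_eq_zero (a := phi t 1 ^ 2) (b := phi t 3 ^ 2),
    hQ, h01, h02, h03, h12, h23, h13, ← not_iff_not, not_not]
  simp only [mul_eq_zero, neg_eq_zero, OfNat.ofNat_ne_zero, false_or]
  constructor
  · intro h
    push Not at h
    obtain ⟨⟨⟨h1, h2⟩, h3⟩, ⟨_, h4⟩, ⟨⟨h5, _⟩, _⟩, ⟨⟨⟨_, h6⟩, h7⟩, _⟩, ⟨_, h8⟩, ⟨⟨_, h9⟩, h10⟩,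
      ⟨⟨h11, _⟩, h12⟩⟩ := h
    exact ⟨h11, h1, h7, h6, h2, h9, h4, h3, h5, h12, h10, h8⟩
  · intro h
    have := h.x0; have := h.y0; have := h.z0; have := h.x1; have := h.y1; have := h.z1
    have := h.xy; have := h.xz; have := h.yz; have := h.hXZ; have := h.hYZ; have := h.hXY
    tauto

/-- The determinant of the linear system for the endomorphism of a normal cycle. -/
def cycleRel (t : Fin 3 → K) : K :=
  t 0 ^ 3 * t 1 ^ 2 - t 0 ^ 3 * t 1 * t 2 - t 0 ^ 3 * t 1 + t 0 ^ 3 * t 2 +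
    t 0 ^ 2 * t 1 ^ 2 * t 2 ^ 2 - 2 * t 0 ^ 2 * t 1 ^ 2 * t 2 - t 0 ^ 2 * t 1 * t 2 ^ 2 +
    3 * t 0 ^ 2 * t 1 * t 2 - t 0 ^ 2 * t 2 ^ 2 - t 0 * t 1 ^ 3 * t 2 ^ 2 +
    2 * t 0 * t 1 ^ 3 * t 2 - t 0 * t 1 ^ 3 - t 0 * t 1 ^ 2 * t 2 + t 0 * t 1 ^ 2 +
    t 0 * t 1 * t 2 ^ 3 + t 0 * t 1 * t 2 ^ 2 - 2 * t 0 * t 1 * t 2 - t 1 * t 2 ^ 3 +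
    t 1 * t 2 ^ 2

/-- This is how the quintic arises: away from `y(y - 1)(x - z) = 0`, its equation is the solvability
condition of the linear system for `f`. -/
theorem quinticVal_phi (t : Fin 3 → K) :
    quinticVal (phi t) = -32 * (t 1 * (t 1 - 1) * (t 0 - t 2)) * cycleRel t := by
  simp only [quinticVal, phi_apply_zero, phi_apply_one, phi_apply_two, phi_apply_three, cycleRel]
  ring

/-- The numerator of `c`, where the endomorphism is `(u - z)(u + c) / (u (u + d))`. -/
def numC (t : Fin 3 → K) : K := t 0 * (t 0 * t 1 - t 0 + t 2) - t 1 * (t 0 - 1 + t 2)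

/-- The numerator of `d`, where the endomorphism is `(u - z)(u + c) / (u (u + d))`. -/
def numD (t : Fin 3 → K) : K :=
  (1 - t 2) * (t 0 ^ 2 * t 1 - t 0 ^ 2 + t 0 * t 2) - (t 0 - t 2) * (t 0 - 1 + t 2)

/-- The coefficients of the endomorphism with a given normal cycle. -/
def endoCoef (t : Fin 3 → K) : Fin 6 → K :=
  ![t 0 * halfXZ t, t 0 * (numC t - t 2 * halfXZ t), -(t 0 * t 2 * numC t), t 0 * halfXZ t,
    numD t, 0]

/-- This quantity and the one in the next lemma are factors of `t 0 * numC t - numD t`, which must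
not vanish if `c ≠ d`. Modulo the quantity, `cycleRel` becomes, up to sign, a product of factors
that are nonzero for a generic cycle. The long cofactor is the quotient of this polynomial division.
-/
theorem sum_ne_zero_of_cycleRel {t : Fin 3 → K} (ht : CycleGeneric t) (h : cycleRel t = 0) :
    t 0 - 1 + t 2 ≠ 0 := by
  intro h'
  refine mul_ne_zero (mul_ne_zero (mul_ne_zero ht.x0 ht.xy) ht.hXZ) ht.hYZ ?_
  unfold halfXZ halfYZ
  unfold cycleRel at h
  linear_combination -h + (t 0 ^ 3 * t 1 + t 0 ^ 2 * t 1 ^ 2 * t 2 - t 0 ^ 2 * t 1 ^ 2 - 3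
      * t 0 ^ 2 * t 1 * t 2 - t 0 * t 1 ^ 3 * t 2 + t 0 * t 1 ^ 3 + t 0 * t 1 ^ 2 * t 2
      - t 0 * t 1 ^ 2 + t 0 * t 1 * t 2 ^ 2 + 2 * t 0 * t 1 * t 2 - t 1 * t 2 ^ 2) * h'

theorem mul_sub_ne_zero_of_cycleRel {t : Fin 3 → K} (ht : CycleGeneric t) (h : cycleRel t = 0) :
    t 0 * t 1 - t 0 + t 2 ≠ 0 := by
  intro h'
  refine mul_ne_zero (mul_ne_zero (mul_ne_zero ht.x0 ht.y1) ht.hXZ) ht.hXY ?_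
  unfold halfXZ halfXY
  unfold cycleRel at h
  linear_combination -h + (-t 0 ^ 2 * t 2 + t 0 ^ 2 - t 0 * t 1 ^ 2 * t 2 + t 0 * t 1 ^ 2
      + t 0 * t 1 * t 2 ^ 2 + t 0 * t 1 * t 2 - 2 * t 0 * t 1 - t 1 * t 2 ^ 2 + t 1 * t
      2) * h'

theorem numC_ne_zero {t : Fin 3 → K} (ht : CycleGeneric t) (h : cycleRel t = 0) : numC t ≠ 0 := by
  intro h'
  refine mul_ne_zero (mul_ne_zero (mul_ne_zero (mul_ne_zero (mul_ne_zero ht.x0 ht.y0) ht.x1)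
    ht.y1) ht.hXZ) ht.hYZ ?_
  unfold halfXZ halfYZ
  unfold cycleRel at h
  unfold numC at h'
  linear_combination (t 0 - t 1) * h + (t 0 ^ 2 * t 1 ^ 2 - t 0 ^ 2 * t 1 + t 0 ^ 2 * t 2
      + t 0 * t 1 ^ 3 * t 2 - t 0 * t 1 ^ 3 - t 0 * t 1 ^ 2 * t 2 + t 0 * t 1 ^ 2 - t 0
      * t 1 * t 2 ^ 2 - t 0 * t 1 * t 2 + t 1 * t 2 ^ 2) * h'

/-- The left side is `x * halfXZ * (c - d)`, so its vanishing detects a common root `-c` of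
numerator and denominator. -/
theorem mul_numC_sub_numD (t : Fin 3 → K) :
    t 0 * numC t - numD t = (t 0 - 1) * (t 0 - 1 + t 2) * (t 0 * t 1 - t 0 + t 2) := by
  unfold numC numD
  ring

/-- The left side is `x * halfXZ * (d + z)`, so its vanishing detects a common root `z` of numerator
and denominator. -/
theorem numD_add (t : Fin 3 → K) :
    numD t + t 2 * (t 0 * halfXZ t) = (t 2 - 1) * (t 0 - t 2) * (2 * t 0 - t 0 * t 1 - 1) := by
  unfold halfXZ numD
  ring

theorem mul_numC_sub_numD_ne_zero {t : Fin 3 → K} (ht : CycleGeneric t) (h : cycleRel t = 0) :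
    t 0 * numC t - numD t ≠ 0 := by
  rw [mul_numC_sub_numD]
  exact mul_ne_zero (mul_ne_zero ht.x1 (sum_ne_zero_of_cycleRel ht h))
    (mul_sub_ne_zero_of_cycleRel ht h)

theorem numD_add_ne_zero {t : Fin 3 → K} (ht : CycleGeneric t) (h : cycleRel t = 0) :
    numD t + t 2 * (t 0 * halfXZ t) ≠ 0 := by
  rw [numD_add]
  refine mul_ne_zero (mul_ne_zero ht.z1 ht.xz) fun h' => ?_
  refine mul_ne_zero (mul_ne_zero (mul_ne_zero ht.x0 ht.hXZ) ht.yz) ht.hXY ?_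
  unfold halfXZ halfXY
  unfold cycleRel at h
  linear_combination -h + (t 0 * t 1 ^ 2 * t 2 - t 0 * t 1 ^ 2 - 2 * t 0 * t 1 * t 2 ^ 2 +
      2 * t 0 * t 1 * t 2 + t 1 * t 2 ^ 3 - t 1 * t 2 ^ 2) * h'

theorem br_normalVec_ne_zero {t : Fin 3 → K} (ht : CycleGeneric t) (i j : Fin 6) (hij : i ≠ j) :
    br (normalVec t i) (normalVec t j) ≠ 0 := by
  have h0 := ht.x0; have h1 := ht.y0; have h2 := ht.z0; have h3 := ht.x1; have h4 := ht.y1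
  have h5 := ht.z1; have h6 := ht.xy; have h7 := ht.xz; have h8 := ht.yz
  fin_cases i <;> fin_cases j <;> simp [normalVec, br] at hij ⊢ <;> grind

theorem quadMap_endoCoef (t : Fin 3 → K) (v : Fin 2 → K) :
    quadMap (endoCoef t) v =
      ![(v 0 - t 2 * v 1) * (t 0 * halfXZ t * v 0 + t 0 * numC t * v 1),
        v 0 * (t 0 * halfXZ t * v 0 + numD t * v 1)] := by
  ext i
  fin_cases i <;> simp [quadMap, endoCoef] <;> ring

/-- Both forms are split. A common finite root would be `0` (with `c = 0`), `z` (with `d = -z`) or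
`-c` (with `c = d`). The point `∞` is excluded by the leading coefficient `x * halfXZ`. -/
theorem quadMap_endoCoef_ne_zero {t : Fin 3 → K} (ht : CycleGeneric t) (h : cycleRel t = 0)
    (v : Fin 2 → K) (hv : v ≠ 0) : quadMap (endoCoef t) v ≠ 0 := by
  contrapose! hv
  rw [quadMap_endoCoef] at hv
  have e0 : (v 0 - t 2 * v 1) * (t 0 * halfXZ t * v 0 + t 0 * numC t * v 1) = 0 := congrFun hv 0
  have e1 : v 0 * (t 0 * halfXZ t * v 0 + numD t * v 1) = 0 := congrFun hv 1
  have hC := numC_ne_zero ht h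
  have hCD := mul_numC_sub_numD_ne_zero ht h
  have hD := numD_add_ne_zero ht h
  suffices v 0 = 0 ∧ v 1 = 0 by
    ext i
    fin_cases i
    exacts [this.1, this.2]
  rcases mul_eq_zero.1 e1 with h0 | h0
  · refine ⟨h0, ?_⟩
    rw [h0] at e0
    have : t 2 * t 0 * numC t * v 1 ^ 2 = 0 := by linear_combination -e0
    simpa [ht.z0, ht.x0, hC] using this
  · have key : v 1 = 0 := by
      rcases mul_eq_zero.1 e0 with h1 | h1
      · refine (mul_eq_zero.1 ?_).resolve_left hD
        linear_combination h0 - t 0 * halfXZ t * h1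
      · refine (mul_eq_zero.1 ?_).resolve_left hCD
        linear_combination h1 - h0
    rw [key] at h0
    exact ⟨by simpa [ht.x0, ht.hXZ] using h0, key⟩

/-- The arrows out of `0`, `∞` and `z` hold by the shape of the endomorphism, `1 ↦ x` and `x ↦ y` by
Cramer's rule, and `y ↦ z` is the remaining relation `cycleRel = 0`. -/
theorem br_quadMap_endoCoef {t : Fin 3 → K} (h : cycleRel t = 0) (i : Fin 6) :
    br (quadMap (endoCoef t) (normalVec t i)) (normalVec t (i + 1)) = 0 := by
  unfold cycleRel at h
  rw [quadMap_endoCoef]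
  fin_cases i <;> simp [normalVec, br, halfXZ, numC, numD]
  · ring
  · ring
  · linear_combination h

/-- The point of `MTilde K` with a given normal cycle. -/
def normalPoint {t : Fin 3 → K} (ht : CycleGeneric t) (h : cycleRel t = 0) : MTilde K :=
  ⟨(Projectivization.mk K (endoCoef t) (by
      intro h0
      refine mul_ne_zero ht.x0 ht.hXZ ?_
      exact congrFun h0 0), normalCycle t),
    (mk_mem_MTilde _ (normalVec_ne_zero t)).2 ⟨br_normalVec_ne_zero ht,
      quadMap_endoCoef_ne_zero ht h, br_quadMap_endoCoef h⟩⟩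

end NormalForm

/-! ### Uniqueness of the endomorphism, and cross-ratios -/

section NormalForm

variable {K : Type*} [Field K]

/-- The necessity of the conditions and of the formula: a common root is excluded by hypothesis, so
`c ≠ 0`, `d ≠ -z` and `c ≠ d`, and these in turn force `X, Y, Z` to be distinct. -/
theorem normal_of_cycle {t : Fin 3 → K} {a : Fin 6 → K}
    (hp : ∀ i j, i ≠ j → br (normalVec t i) (normalVec t j) ≠ 0)
    (hq : ∀ x : Fin 2 → K, x ≠ 0 → quadMap a x ≠ 0)
    (hc : ∀ i, br (quadMap a (normalVec t i)) (normalVec t (i + 1)) = 0) :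
    CycleGeneric t ∧ cycleRel t = 0 ∧ ∃ l : K, endoCoef t = l • a := by
  have x0 : t 0 ≠ 0 := by simpa [br, normalVec] using hp 0 3 (by decide)
  have y0 : t 1 ≠ 0 := by simpa [br, normalVec] using hp 0 4 (by decide)
  have z0 : t 2 ≠ 0 := by simpa [br, normalVec] using hp 0 5 (by decide)
  have x1 : t 0 - 1 ≠ 0 := by simpa [br, normalVec] using hp 3 2 (by decide)
  have y1 : t 1 - 1 ≠ 0 := by simpa [br, normalVec] using hp 4 2 (by decide)
  have z1 : t 2 - 1 ≠ 0 := by simpa [br, normalVec] using hp 5 2 (by decide)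
  have xy : t 0 - t 1 ≠ 0 := by simpa [br, normalVec] using hp 3 4 (by decide)
  have xz : t 0 - t 2 ≠ 0 := by simpa [br, normalVec] using hp 3 5 (by decide)
  have yz : t 1 - t 2 ≠ 0 := by simpa [br, normalVec] using hp 4 5 (by decide)
  have a5 : a 5 = 0 := by simpa [br, normalVec, quadMap] using hc 0
  have a3 : a 0 - a 3 = 0 := by simpa [br, normalVec, quadMap] using hc 1
  have e1 : (a 0 + a 1 + a 2) - (a 3 + a 4 + a 5) * t 0 = 0 := by
    simpa [br, normalVec, quadMap] using hc 2
  have e2 : (a 0 * t 0 ^ 2 + a 1 * t 0 + a 2) - (a 3 * t 0 ^ 2 + a 4 * t 0 + a 5) * t 1 = 0 := by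
    simpa [br, normalVec, quadMap] using hc 3
  have e3 : (a 0 * t 1 ^ 2 + a 1 * t 1 + a 2) - (a 3 * t 1 ^ 2 + a 4 * t 1 + a 5) * t 2 = 0 := by
    simpa [br, normalVec, quadMap] using hc 4
  have e4 : a 0 * t 2 ^ 2 + a 1 * t 2 + a 2 = 0 := by
    simpa [br, normalVec, quadMap] using hc 5
  have a0 : a 0 ≠ 0 := by
    intro h0
    refine hq ![1, 0] (by simp) ?_
    have h3 : a 3 = 0 := by linear_combination h0 - a3
    ext i
    fin_cases i <;> simp [quadMap, h0, h3]
  obtain ⟨c, ha1⟩ : ∃ c, a 1 = a 0 * (c - t 2) := ⟨a 1 / a 0 + t 2, by field_simp; ring⟩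
  obtain ⟨d, ha4⟩ : ∃ d, a 4 = a 0 * d := ⟨a 4 / a 0, by field_simp⟩
  have ha3 : a 3 = a 0 := by linear_combination -a3
  have ha2 : a 2 = -(a 0 * (t 2 * c)) := by
    rw [ha1] at e4
    linear_combination e4
  rw [ha1, ha2, ha3, ha4, a5] at e1 e2 e3
  replace e1 : (1 - t 2) * (1 + c) - t 0 * (1 + d) = 0 :=
    mul_left_cancel₀ a0 (by linear_combination e1)
  replace e2 : (t 0 - t 2) * (t 0 + c) - t 0 * t 1 * (t 0 + d) = 0 :=
    mul_left_cancel₀ a0 (by linear_combination e2)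
  replace e3 : (t 1 - t 2) * (t 1 + c) - t 1 * t 2 * (t 1 + d) = 0 :=
    mul_left_cancel₀ a0 (by linear_combination e3)
  have hc0 : c ≠ 0 := by
    rintro rfl
    refine hq ![0, 1] (by simp) ?_
    ext i
    fin_cases i <;> simp [quadMap, ha2, a5]
  have hdz : d + t 2 ≠ 0 := by
    intro h
    refine hq ![t 2, 1] (by simp) ?_
    ext i
    fin_cases i
    · simpa [quadMap] using e4
    · change a 3 * t 2 ^ 2 + a 4 * t 2 * 1 + a 5 * 1 ^ 2 = 0
      rw [ha3, ha4, a5]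
      linear_combination a 0 * t 2 * h
  have hcd : c - d ≠ 0 := by
    intro h
    refine hq ![-c, 1] (by simp) ?_
    ext i
    fin_cases i
    · change a 0 * (-c) ^ 2 + a 1 * -c * 1 + a 2 * 1 ^ 2 = 0
      rw [ha1, ha2]
      ring
    · change a 3 * (-c) ^ 2 + a 4 * -c * 1 + a 5 * 1 ^ 2 = 0
      rw [ha3, ha4, a5]
      linear_combination a 0 * c * h
  have hE : cycleRel t = 0 := by
    unfold cycleRel
    -- The multipliers are the `2 × 2` minors of the coefficients of `c` and `d`; this is the
    -- expansion of the `3 × 3` determinant along the column of constants.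
    linear_combination -((t 0 - t 2) * (t 1 * t 2) - (t 1 - t 2) * (t 0 * t 1)) * e1 +
      ((1 - t 2) * (t 1 * t 2) - (t 1 - t 2) * t 0) * e2 -
      ((1 - t 2) * (t 0 * t 1) - (t 0 - t 2) * t 0) * e3
  have hXZ : halfXZ t ≠ 0 := by
    intro h
    unfold halfXZ at h
    -- When `halfXZ = 0`, the coefficient rows of `e1` and `e2` are proportional. Comparing the two
    -- equations gives `1 - z = x`, and then `e1` reads `x(c - d) = 0`.
    have h1 : t 1 * ((1 - t 2) * (t 0 + c) - t 0 * (t 0 + d)) = 0 := by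
      linear_combination e2 - (t 0 + c) * h
    have h2 : (t 0 - 1) * (1 - t 2 - t 0) = 0 := by
      linear_combination (mul_eq_zero.1 h1).resolve_left y0 - e1
    have h3 := (mul_eq_zero.1 h2).resolve_left x1
    refine mul_ne_zero x0 hcd ?_
    linear_combination e1 - (1 + c) * h3
  -- Cramer's rule for `e1` and `e2`, whose determinant in `c` and `d` is `x * halfXZ`.
  have hC : halfXZ t * c = numC t := by
    refine mul_left_cancel₀ x0 ?_
    unfold halfXZ numC
    linear_combination -(t 0 * t 1) * e1 + t 0 * e2
  have hD : t 0 * halfXZ t * d = numD t := by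
    unfold halfXZ numD
    linear_combination -(t 0 - t 2) * e1 + (1 - t 2) * e2
  have hYZ : halfYZ t ≠ 0 := by
    intro h
    -- Together with `halfYZ = 0`, the relation forces `x - 1 + z = 0`, hence `c = d`, or `numC =
    -- 0`, hence `c = 0`. The argument for `halfXY` is similar, leading to `d = -z` or `c = d`.
    have h1 : t 0 * t 1 * (t 1 - 1) * (t 0 - 1 + t 2) * numC t = 0 := by
      unfold halfYZ at h
      unfold cycleRel at hE
      unfold numC
      linear_combination hE + (t 0 ^ 3 * t 1 ^ 2 - 2 * t 0 ^ 3 * t 1 + t 0 ^ 3 + t 0 ^ 2 * t 1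
        ^ 2 * t 2 - 2 * t 0 ^ 2 * t 1 ^ 2 + 2 * t 0 ^ 2 * t 1 - t 0 ^ 2 * t 2 - 2 * t 0
        * t 1 ^ 2 * t 2 + 2 * t 0 * t 1 ^ 2 + t 0 * t 1 * t 2 ^ 2 + t 0 * t 1 * t 2 - 2
        * t 0 * t 1 - t 1 * t 2 ^ 2 + t 1 * t 2) * h
    simp only [mul_eq_zero, x0, y0, y1, false_or] at h1
    rcases h1 with h1 | h1
    · refine mul_ne_zero (mul_ne_zero x0 hXZ) hcd ?_
      have := mul_numC_sub_numD t
      rw [h1, ← hC, ← hD] at this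
      linear_combination this
    · exact mul_ne_zero hXZ hc0 (hC.trans h1)
  have hXY : halfXY t ≠ 0 := by
    intro h
    have h1 : t 1 * (t 2 - 1) * (t 0 - t 2) * (2 * t 0 - t 0 * t 1 - 1) *
        (t 0 * t 1 - t 0 + t 2) = 0 := by
      unfold halfXY at h
      unfold cycleRel at hE
      linear_combination -hE + (t 0 ^ 2 * t 1 ^ 2 * t 2 - t 0 ^ 2 * t 1 ^ 2 - 2 * t 0 ^ 2 * t
        1 * t 2 + t 0 ^ 2 * t 1 + t 0 ^ 2 * t 2 - t 0 * t 1 ^ 2 * t 2 + t 0 * t 1 ^ 2 +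
        t 0 * t 1 * t 2 ^ 2 + t 0 * t 1 * t 2 - t 0 * t 1 - t 0 * t 2 ^ 2) * h
    simp only [mul_eq_zero, xz, y0, z1, false_or] at h1
    rcases h1 with h1 | h1
    · refine mul_ne_zero (mul_ne_zero x0 hXZ) hdz ?_
      have := numD_add t
      rw [h1, ← hD] at this
      linear_combination this
    · refine mul_ne_zero (mul_ne_zero x0 hXZ) hcd ?_
      have := mul_numC_sub_numD t
      rw [h1, ← hC, ← hD] at this
      linear_combination this
  refine ⟨⟨x0, y0, z0, x1, y1, z1, xy, xz, yz, hXZ, hYZ, hXY⟩, hE, t 0 * halfXZ t / a 0, ?_⟩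
  ext i
  fin_cases i <;> simp [endoCoef, ha1, ha2, ha3, ha4, a5, ← hC, ← hD] <;> field_simp

theorem eq_normalPoint {t : Fin 3 → K} (m : MTilde K) (hm : m.1.2 = normalCycle t) :
    ∃ (ht : CycleGeneric t) (h : cycleRel t = 0), m = normalPoint ht h := by
  obtain ⟨⟨f, p⟩, hmem⟩ := m
  dsimp only at hm
  subst hm
  induction f using Projectivization.ind with | h a ha =>
  obtain ⟨hp, hq, hc⟩ := (mk_mem_MTilde ha (normalVec_ne_zero t)).1 hmem
  obtain ⟨ht, h, l, hl⟩ := normal_of_cycle hp hq hc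
  refine ⟨ht, h, Subtype.ext (Prod.ext ?_ rfl)⟩
  symm
  exact (Projectivization.mk_eq_mk_iff' _ _ _ _ _).2 ⟨l, hl.symm⟩

/-- The cross-ratio, as the coordinate of `s` for which `p, q, r` are `0, ∞, 1`. -/
def crossRatio (p q r s : Fin 2 → K) : K := br p s * br q r / (br q s * br p r)

theorem br_smul_smul (a b : K) (p q : Fin 2 → K) : br (a • p) (b • q) = a * b * br p q := by
  simp only [br, Pi.smul_apply, smul_eq_mul]
  ring

theorem crossRatio_smul {a b c d : K} (ha : a ≠ 0) (hb : b ≠ 0) (hc : c ≠ 0) (hd : d ≠ 0)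
    (p q r s : Fin 2 → K) :
    crossRatio (a • p) (b • q) (c • r) (d • s) = crossRatio p q r s := by
  simp only [crossRatio, br_smul_smul]
  rw [← mul_div_mul_left (br p s * br q r) _ (mul_ne_zero (mul_ne_zero ha hb) (mul_ne_zero hc hd))]
  ring

theorem br_mulVec (M : Matrix (Fin 2) (Fin 2) K) (p q : Fin 2 → K) :
    br (M.mulVec p) (M.mulVec q) = M.det * br p q := by
  simp only [br, Matrix.mulVec, dotProduct, Fin.sum_univ_two, Matrix.det_fin_two]
  ring

theorem crossRatio_mulVec {M : Matrix (Fin 2) (Fin 2) K} (hM : M.det ≠ 0) (p q r s : Fin 2 → K) :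
    crossRatio (M.mulVec p) (M.mulVec q) (M.mulVec r) (M.mulVec s) = crossRatio p q r s := by
  simp only [crossRatio, br_mulVec]
  rw [← mul_div_mul_left (br p s * br q r) _ (mul_ne_zero hM hM)]
  ring

/-- The affine coordinates `x, y, z` of the normal form of a cycle. -/
def cycleCoord (p : Fin 6 → ℙ K (Fin 2 → K)) : Fin 3 → K :=
  fun j => crossRatio (p 0).rep (p 1).rep (p 2).rep (p (Fin.natAdd 3 j)).rep

theorem cycleCoord_mk {p : Fin 6 → Fin 2 → K} (hp : ∀ i, p i ≠ 0) (j : Fin 3) :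
    cycleCoord (fun i => Projectivization.mk K (p i) (hp i)) j =
      crossRatio (p 0) (p 1) (p 2) (p (Fin.natAdd 3 j)) := by
  choose c hc using fun i => Projectivization.exists_smul_eq_mk_rep K (p i) (hp i)
  simp only [cycleCoord, ← hc, Units.smul_def]
  exact crossRatio_smul (c 0).ne_zero (c 1).ne_zero (c 2).ne_zero (c _).ne_zero _ _ _ _

theorem cycleCoord_smul (ν : PGL(Fin 2, K)) (p : Fin 6 → ℙ K (Fin 2 → K)) :
    cycleCoord (fun i => ν • p i) = cycleCoord p := by
  obtain ⟨g, rfl⟩ := Matrix.ProjGenLinGroup.mk_surjective ν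
  obtain ⟨q, hq, rfl⟩ : ∃ (q : Fin 6 → Fin 2 → K) (hq : ∀ i, q i ≠ 0),
      p = fun i => Projectivization.mk K (q i) (hq i) :=
    ⟨fun i => (p i).rep, fun i => (p i).rep_nonzero, funext fun i => (p i).mk_rep.symm⟩
  ext j
  simp only [Projectivization.PGL.mk_smul_mk]
  rw [cycleCoord_mk, cycleCoord_mk]
  exact crossRatio_mulVec (Matrix.GeneralLinearGroup.det_ne_zero g) _ _ _ _

theorem cycleCoord_normalCycle (t : Fin 3 → K) : cycleCoord (normalCycle t) = t := by
  ext j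
  rw [normalCycle_eq, cycleCoord_mk]
  fin_cases j <;> simp [crossRatio, br, normalVec, Fin.natAdd]

end NormalForm

/-! ### Orbits of `PGL₂` and the bijection with the open part -/

section Quotient

variable {K : Type*} [Field K]

/-- The coefficients of the conjugate of a quadratic map by a matrix, up to the square of the
determinant. -/
def conjCoef (M : Matrix (Fin 2) (Fin 2) K) (a : Fin 6 → K) : Fin 6 → K :=
  let b (c : Fin 3 → K) : Fin 3 → K :=
    ![c 0 * M 1 1 ^ 2 - c 1 * M 1 1 * M 1 0 + c 2 * M 1 0 ^ 2,
      -2 * c 0 * M 1 1 * M 0 1 + c 1 * (M 1 1 * M 0 0 + M 0 1 * M 1 0) - 2 * c 2 * M 1 0 * M 0 0,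
      c 0 * M 0 1 ^ 2 - c 1 * M 0 1 * M 0 0 + c 2 * M 0 0 ^ 2]
  let p := b ![a 0, a 1, a 2]
  let q := b ![a 3, a 4, a 5]
  ![M 0 0 * p 0 + M 0 1 * q 0, M 0 0 * p 1 + M 0 1 * q 1, M 0 0 * p 2 + M 0 1 * q 2,
    M 1 0 * p 0 + M 1 1 * q 0, M 1 0 * p 1 + M 1 1 * q 1, M 1 0 * p 2 + M 1 1 * q 2]

/-- The coefficients are those of `M ∘ f ∘ adj M`. Since `adj M * M` is the scalar `det M` and `f`
is quadratic, the square of the determinant appears. -/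
theorem quadMap_conjCoef (M : Matrix (Fin 2) (Fin 2) K) (a : Fin 6 → K) (v : Fin 2 → K) :
    quadMap (conjCoef M a) (M.mulVec v) = M.det ^ 2 • M.mulVec (quadMap a v) := by
  ext i
  fin_cases i <;> simp [quadMap, conjCoef, Matrix.mulVec, dotProduct, Fin.sum_univ_two,
    Matrix.det_fin_two] <;> ring

/-- The matrix sending `p, q, r` to `0, ∞, 1`. -/
def normalizer (p q r : Fin 2 → K) : Matrix (Fin 2) (Fin 2) K :=
  !![-(p 1 * br q r), p 0 * br q r; -(q 1 * br p r), q 0 * br p r]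

theorem normalizer_mulVec (p q r v : Fin 2 → K) :
    (normalizer p q r).mulVec v = ![br q r * br p v, br p r * br q v] := by
  ext i
  fin_cases i <;> simp [normalizer, br, Matrix.mulVec, dotProduct, Fin.sum_univ_two] <;> ring

theorem det_normalizer (p q r : Fin 2 → K) :
    (normalizer p q r).det = br q r * br p r * br p q := by
  simp [normalizer, br, Matrix.det_fin_two]
  ring

theorem exists_lift (m : MTilde K) : ∃ (a : Fin 6 → K) (ha : a ≠ 0) (p : Fin 6 → Fin 2 → K)
    (hp : ∀ i, p i ≠ 0), m.1 = (Projectivization.mk K a ha,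
      fun i => Projectivization.mk K (p i) (hp i)) :=
  ⟨m.1.1.rep, m.1.1.rep_nonzero, fun i => (m.1.2 i).rep, fun i => (m.1.2 i).rep_nonzero,
    Prod.ext (m.1.1.mk_rep).symm (funext fun i => (m.1.2 i).mk_rep.symm)⟩

/-- Conjugation by the matrix taking the first three points to `0, ∞, 1` keeps the class. The
remaining points then acquire their cross-ratios as coordinates. -/
theorem exists_normal (m : MTilde K) :
    ∃ m' : MTilde K, m'.1.2 = normalCycle (cycleCoord m.1.2) ∧ Moduli.mk m' = Moduli.mk m := by
  obtain ⟨a, ha, p, hp, hm⟩ := exists_lift m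
  obtain ⟨hbr, hq, hc⟩ := (mk_mem_MTilde ha hp).1 (hm ▸ m.2)
  set M := normalizer (p 0) (p 1) (p 2) with hM
  have hdet : M.det ≠ 0 := by
    rw [hM, det_normalizer]
    exact mul_ne_zero (mul_ne_zero (hbr 1 2 (by decide)) (hbr 0 2 (by decide)))
      (hbr 0 1 (by decide))
  let g : GL (Fin 2) K := Matrix.GeneralLinearGroup.mkOfDetNeZero M hdet
  have hM0 {v : Fin 2 → K} (hv : v ≠ 0) : M.mulVec v ≠ 0 := (smul_ne_zero_iff_ne g).2 hv
  have hq' : ∀ x : Fin 2 → K, x ≠ 0 → quadMap (conjCoef M a) x ≠ 0 := by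
    intro x hx
    obtain ⟨y, rfl⟩ : ∃ y, M.mulVec y = x := ⟨g⁻¹ • x, smul_inv_smul g x⟩
    have hy : y ≠ 0 := by
      rintro rfl
      exact hx (Matrix.mulVec_zero M)
    rw [quadMap_conjCoef]
    exact smul_ne_zero (pow_ne_zero 2 hdet) (hM0 (hq y hy))
  have ha' : conjCoef M a ≠ 0 := by
    intro h
    refine hq' ![1, 0] (by simp) ?_
    rw [h]
    ext i
    fin_cases i <;> simp [quadMap]
  have hmem := (mk_mem_MTilde ha' fun i => hM0 (hp i)).2 ⟨fun i j hij => by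
      rw [br_mulVec]
      exact mul_ne_zero hdet (hbr i j hij), hq', fun i => by
      have := br_smul_smul (M.det ^ 2) 1 (M.mulVec (quadMap a (p i))) (M.mulVec (p (i + 1)))
      rw [one_smul] at this
      rw [quadMap_conjCoef, this, br_mulVec, hc, mul_zero, mul_zero]⟩
  refine ⟨⟨_, hmem⟩, ?_, Quotient.sound ((orbitSetoid K).symm ⟨.mk g, fun x => ?_, fun i => ?_⟩)⟩
  · funext i
    have ht (j : Fin 3) : cycleCoord m.1.2 j =
        crossRatio (p 0) (p 1) (p 2) (p (Fin.natAdd 3 j)) := by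
      rw [hm]
      exact cycleCoord_mk hp j
    rw [normalCycle_eq]
    refine (mk_eq_mk_iff_br _ _).2 ?_
    have hj (j : Fin 3) : br (M.mulVec (p (Fin.natAdd 3 j))) ![cycleCoord m.1.2 j, 1] = 0 := by
      have h1 : br (p 1) (p (Fin.natAdd 3 j)) ≠ 0 := hbr _ _ (by revert j; decide)
      have h2 : br (p 0) (p 2) ≠ 0 := hbr _ _ (by decide)
      rw [hM, normalizer_mulVec, ht, crossRatio, br]
      simp only [Matrix.cons_val]
      field_simp
      ring
    rw [hM] at hj ⊢
    fin_cases i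
    · change br (Matrix.mulVec _ (p 0)) ![0, 1] = 0
      rw [normalizer_mulVec]
      simp [br]
      ring_nf
      simp
    · change br (Matrix.mulVec _ (p 1)) ![1, 0] = 0
      rw [normalizer_mulVec]
      simp [br]
      ring_nf
      simp
    · change br (Matrix.mulVec _ (p 2)) ![1, 1] = 0
      rw [normalizer_mulVec]
      simp [br]
      ring
    · exact hj 0
    · exact hj 1
    · exact hj 2
  · induction x using Projectivization.ind with | h v hv =>
    rw [End2.app_mk (endo m) ha (congrArg Prod.fst hm) hv (hq v hv),
      Projectivization.PGL.mk_smul_mk, Projectivization.PGL.mk_smul_mk]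
    have hgv : g • v = M.mulVec v := rfl
    have hgq : g • quadMap a v = M.mulVec (quadMap a v) := rfl
    rw [End2.app_mk _ ha' rfl _ (hq' _ ((smul_ne_zero_iff_ne g).2 hv)),
      Projectivization.mk_eq_mk_iff']
    exact ⟨M.det ^ 2, by rw [hgv, hgq, quadMap_conjCoef]⟩
  · rw [hm]
    rfl

/-- The coordinates of the normal form of a class. -/
def Moduli.coord : Moduli K → Fin 3 → K :=
  Quotient.lift (fun m : MTilde K => cycleCoord m.1.2) (by
    rintro m n ⟨ν, -, h⟩
    rw [show n.1.2 = fun i => ν • m.1.2 i from funext h, cycleCoord_smul])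

theorem Moduli.coord_mk (m : MTilde K) : (Moduli.mk m).coord = cycleCoord m.1.2 := rfl

/-- A class is recovered from its coordinates because the normal cycle determines the endomorphism.
Thus the classes correspond to the generic zeros of `cycleRel`. -/
theorem Moduli.exists_eq_mk_normalPoint (c : Moduli K) :
    ∃ (ht : CycleGeneric c.coord) (h : cycleRel c.coord = 0), Moduli.mk (normalPoint ht h) = c := by
  induction c using Quotient.ind with | _ m =>
  obtain ⟨m', hm', e⟩ := exists_normal m
  obtain ⟨ht, h, rfl⟩ := eq_normalPoint m' hm'
  exact ⟨ht, h, e⟩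

theorem Moduli.coord_mk_normalPoint {t : Fin 3 → K} (ht : CycleGeneric t) (h : cycleRel t = 0) :
    (Moduli.mk (normalPoint ht h)).coord = t := by
  rw [Moduli.coord_mk]
  exact cycleCoord_normalCycle t

theorem Moduli.mk_normalPoint {t : Fin 3 → K} (ht : CycleGeneric t) (h : cycleRel t = 0)
    {c : Moduli K} (hc : t = c.coord) : Moduli.mk (normalPoint ht h) = c := by
  subst hc
  obtain ⟨_, _, e⟩ := c.exists_eq_mk_normalPoint
  exact e

theorem Moduli.existsUnique_normal (c : Moduli K) :
    ∃! t : Fin 3 → K, ∃ m : MTilde K, m.1.2 = normalCycle t ∧ Moduli.mk m = c := by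
  obtain ⟨ht, h, e⟩ := c.exists_eq_mk_normalPoint
  refine ⟨c.coord, ⟨_, rfl, e⟩, ?_⟩
  rintro t ⟨m, hm, rfl⟩
  rw [Moduli.coord_mk, hm, cycleCoord_normalCycle]

theorem isGeneric_smul {c : K} (hc : c ≠ 0) {v : Fin 4 → K} : IsGeneric (c • v) ↔ IsGeneric v := by
  rw [← not_iff_not, not_isGeneric_iff, not_isGeneric_iff, quadForm_smul]
  simp [mul_pow, hc]

theorem isGeneric_rep_mk {v : Fin 4 → K} (hv : v ≠ 0) :
    IsGeneric (Projectivization.mk K v hv).rep ↔ IsGeneric v := by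
  obtain ⟨c, hc⟩ := Projectivization.exists_smul_eq_mk_rep K v hv
  rw [← hc, Units.smul_def, isGeneric_smul c.ne_zero]

/-- Distinct squares have nonzero sums and differences of roots, so the open part lies where the
inverse of `φ` is defined. -/
theorem IsGeneric.mem_coneDomain {v : Fin 4 → K} (hv : IsGeneric v) : v ∈ coneDomain K := by
  have h (i j : Fin 4) (hij : i ≠ j) : (v i - v j) * (v i + v j) ≠ 0 := by
    intro h
    exact hij (hv.2 (by linear_combination h))
  exact mul_ne_zero (mul_ne_zero (mul_ne_zero hv.1 (right_ne_zero_of_mul (h 1 2 (by decide))))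
    (right_ne_zero_of_mul (h 0 2 (by decide)))) (left_ne_zero_of_mul (h 0 1 (by decide)))

/-- The open subset of the quintic that is isomorphic to the moduli space. -/
def openPart (K : Type*) [Field K] : Set (ℙ K (Fin 4 → K)) := {p ∈ S6 K | IsGeneric p.rep}

theorem mk_mem_openPart {v : Fin 4 → K} (hv : v ≠ 0) :
    Projectivization.mk K v hv ∈ openPart K ↔ quinticVal v = 0 ∧ IsGeneric v :=
  and_congr (mk_mem_S6 hv) (isGeneric_rep_mk hv)

theorem openPart_subset_projDomain : openPart K ⊆ projDomain K :=
  fun _ hp => IsGeneric.mem_coneDomain hp.2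

/-- The effect of the rotation of a cycle on its coordinates. -/
def rotateCoord (t : Fin 3 → K) : Fin 3 → K :=
  -- The transformation `u ↦ (x - 1)/(u - 1)` takes `∞, 1, x` to `0, ∞, 1`; the entries are the
  -- images of `y`, `z` and `0`.
  ![(t 0 - 1) / (t 1 - 1), (t 0 - 1) / (t 2 - 1), 1 - t 0]

theorem cycleCoord_rotate (t : Fin 3 → K) :
    cycleCoord (fun i => normalCycle t (i + 1)) = rotateCoord t := by
  ext j
  rw [normalCycle_eq]
  rw [cycleCoord_mk (fun i => normalVec_ne_zero t (i + 1))]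
  fin_cases j
  · simp [crossRatio, br, normalVec, Fin.natAdd, rotateCoord]
    rw [← neg_sub (t 0), ← neg_sub (t 1), neg_div_neg_eq]
  · simp [crossRatio, br, normalVec, Fin.natAdd, rotateCoord]
    rw [← neg_sub (t 0), ← neg_sub (t 2), neg_div_neg_eq]
  · simp [crossRatio, br, normalVec, Fin.natAdd, rotateCoord]

theorem phi_rotateCoord {t : Fin 3 → K} (ht : CycleGeneric t) :
    phi (rotateCoord t) = (-(t 0 - 1) / ((t 1 - 1) * (t 2 - 1))) • tauLin (phi t) := by
  have h1 := ht.y1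
  have h2 := ht.z1
  ext i
  fin_cases i <;> simp [phi, rotateCoord, tauLin] <;> field_simp <;> ring

variable [CharZero K]

theorem mk_phi_mem_openPart {t : Fin 3 → K} (ht : CycleGeneric t) (h : cycleRel t = 0) :
    Projectivization.mk K (phi t) (phi_ne_zero ht.mem_affineDomain) ∈ openPart K := by
  rw [mk_mem_openPart, quinticVal_phi, h, mul_zero, isGeneric_phi_iff]
  exact ⟨rfl, ht⟩

theorem psi_rep_of_mem_openPart {p : ℙ K (Fin 4 → K)} (hp : p ∈ openPart K) :
    CycleGeneric (psi p.rep) ∧ cycleRel (psi p.rep) = 0 := by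
  have hd : p.rep ∈ coneDomain K := hp.2.mem_coneDomain
  have e := mk_phi_psi hd
  rw [Projectivization.mk_rep] at e
  rw [← e, mk_mem_openPart, isGeneric_phi_iff, quinticVal_phi] at hp
  have ht := hp.2
  exact ⟨ht, by simpa [ht.y0, ht.y1, ht.xz] using hp.1⟩

/-- The bijection between the moduli space and an open subset of the quintic. -/
def moduliEquiv (K : Type*) [Field K] [CharZero K] : Moduli K ≃ openPart K where
  toFun c := ⟨Projectivization.mk K (phi c.coord)
      (phi_ne_zero c.exists_eq_mk_normalPoint.1.mem_affineDomain),
    mk_phi_mem_openPart c.exists_eq_mk_normalPoint.1 c.exists_eq_mk_normalPoint.2.1⟩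
  invFun p := Moduli.mk (normalPoint (psi_rep_of_mem_openPart p.2).1
    (psi_rep_of_mem_openPart p.2).2)
  left_inv c := Moduli.mk_normalPoint _ _ ((psi_rep_mk _).trans
    (psi_phi c.exists_eq_mk_normalPoint.1.mem_affineDomain))
  right_inv p := by
    refine Subtype.ext ?_
    have e := mk_phi_psi (openPart_subset_projDomain p.2)
    rw [Projectivization.mk_rep] at e
    refine Eq.trans ?_ e
    change Projectivization.mk K _ _ = _
    congr 1
    rw [Moduli.coord_mk_normalPoint]

theorem moduliEquiv_mk (m : MTilde K) (t : Fin 3 → K) (hm : m.1.2 = normalCycle t) :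
    ∃ h : phi t ≠ 0, (moduliEquiv K (Moduli.mk m)).1 = Projectivization.mk K (phi t) h := by
  obtain ⟨ht, h, rfl⟩ := eq_normalPoint m hm
  refine ⟨phi_ne_zero ht.mem_affineDomain, ?_⟩
  change Projectivization.mk K _ _ = _
  congr 1
  rw [Moduli.coord_mk_normalPoint]

theorem moduliEquiv_sigma6 (c : Moduli K) :
    (moduliEquiv K (sigma6 c)).1 = tau (moduliEquiv K c).1 := by
  obtain ⟨ht, h, e⟩ := c.exists_eq_mk_normalPoint
  have e' : (sigma6 c).coord = rotateCoord c.coord := by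
    conv_lhs => rw [← e]
    exact cycleCoord_rotate c.coord
  change Projectivization.mk K _ _ = Projectivization.map _ _ (Projectivization.mk K _ _)
  rw [Projectivization.map_mk, Projectivization.mk_eq_mk_iff', e', phi_rotateCoord ht]
  exact ⟨_, rfl⟩

end Quotient

/-! ### The bijection is an isomorphism of varieties -/

section ModuliIso

open FunSpace

variable (k : Type*) (K : Type*) [Field k] [Field K] [Algebra k K]

/-- The points of the product of the cones over the factors of `ℙ⁵ × (ℙ¹)⁶`. -/
abbrev AmbientCone := {a : Fin 6 → K // a ≠ 0} × (Fin 6 → {v : Fin 2 → K // v ≠ 0})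

/-- The product of the cones over the factors of `ℙ⁵ × (ℙ¹)⁶`. -/
def ambientConeSpace : FunSpace K (AmbientCone K) :=
  (affineSpace k K (Fin 6 ⊕ (Fin 6 × Fin 2))).induced
    (fun c => Sum.elim c.1.1 (fun ij => (c.2 ij.1).1 ij.2))

variable {K} in
/-- The projection to `ℙ⁵ × (ℙ¹)⁶`. -/
def ambientProj (c : AmbientCone K) : ℙ K (Fin 6 → K) × (Fin 6 → ℙ K (Fin 2 → K)) :=
  (Projectivization.mk' K c.1, fun i => Projectivization.mk' K (c.2 i))

theorem ambientSpace_eq : ambientSpace k K = (ambientConeSpace k K).quotient ambientProj := rfl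

theorem isGood_ambientConeSpace : IsGood k (ambientConeSpace k K) :=
  (isGood_affineSpace k K _).induced _

theorem isGood_ambientSpace : IsGood k (ambientSpace k K) :=
  (isGood_ambientConeSpace k K).quotient _

theorem regular_ambientCone (i : Fin 6) (j : Fin 2) :
    (ambientConeSpace k K).regular Set.univ fun c => (c.2 i).1 j :=
  (hom_induced (affineSpace k K (Fin 6 ⊕ (Fin 6 × Fin 2)))
    (fun c : AmbientCone K => Sum.elim c.1.1 (fun ij => (c.2 ij.1).1 ij.2))).regular_coord
    (Sum.inr (i, j))

theorem regular_br (i j : Fin 6) :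
    (ambientConeSpace k K).regular Set.univ fun c => br (c.2 i).1 (c.2 j).1 :=
  (isGood_ambientConeSpace k K).sub
    ((isGood_ambientConeSpace k K).mul (regular_ambientCone k K i 0) (regular_ambientCone k K j 1))
    ((isGood_ambientConeSpace k K).mul (regular_ambientCone k K i 1) (regular_ambientCone k K j 0))

/-- The open subset of `ℙ⁵ × (ℙ¹)⁶` where the denominators of the cross-ratios do not vanish. -/
def crossRatioDomain : Set (ℙ K (Fin 6 → K) × (Fin 6 → ℙ K (Fin 2 → K))) :=
  {q | q.2 1 ≠ q.2 3 ∧ q.2 1 ≠ q.2 4 ∧ q.2 1 ≠ q.2 5 ∧ q.2 0 ≠ q.2 2}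

theorem ambientProj_mem_crossRatioDomain {c : AmbientCone K} :
    ambientProj c ∈ crossRatioDomain K ↔ br (c.2 1).1 (c.2 3).1 * br (c.2 1).1 (c.2 4).1 *
      br (c.2 1).1 (c.2 5).1 * br (c.2 0).1 (c.2 2).1 ≠ 0 := by
  have h (i j : Fin 6) : (ambientProj c).2 i ≠ (ambientProj c).2 j ↔
      br (c.2 i).1 (c.2 j).1 ≠ 0 := not_congr (mk_eq_mk_iff_br (c.2 i).2 (c.2 j).2)
  simp only [crossRatioDomain, Set.mem_ofPred_eq, h, ne_eq, mul_eq_zero, not_or, and_assoc]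

/-- Regularity can be checked on the cone only over an open subset of the product, and the space of
cycles need not be open there. Hence the passage to the larger open set where the cross-ratios are
defined. -/
theorem hom_cycleCoord_crossRatioDomain :
    Hom ((ambientSpace k K).induced (Subtype.val : crossRatioDomain K → _))
      (affineSpace k K (Fin 3)) fun q => cycleCoord q.1.2 := by
  have hA := isGood_ambientConeSpace k K
  have hb := regular_br k K
  rw [ambientSpace_eq]
  refine Hom.of_comp_quotient_restrict hA ?_ ?_
  · convert hA.isOpen_ne (isOpen_univ _)
      (hA.mul (hA.mul (hA.mul (hb 1 3) (hb 1 4)) (hb 1 5)) (hb 0 2)) using 1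
    ext c
    exact (ambientProj_mem_crossRatioDomain K).trans (by simp)
  · have hB := hA.induced (Subtype.val : ambientProj ⁻¹' crossRatioDomain K → AmbientCone K)
    have hb (i j : Fin 6) := (hom_induced (ambientConeSpace k K)
      (Subtype.val : ambientProj ⁻¹' crossRatioDomain K → _)).regular (hb i j)
    refine Hom.into_affineSpace hB fun j => ?_
    refine hB.congr (f := fun c : (ambientProj ⁻¹' crossRatioDomain K : Set (AmbientCone K)) =>
      crossRatio (c.1.2 0).1 (c.1.2 1).1 (c.1.2 2).1 (c.1.2 (Fin.natAdd 3 j)).1)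
      (fun c _ => (cycleCoord_mk (fun i => (c.1.2 i).2) j).symm) ?_
    refine hB.div (hB.mul (hb _ _) (hb _ _)) (hB.mul (hb _ _) (hb _ _)) fun c _ => ?_
    have := (ambientProj_mem_crossRatioDomain K).1 c.2
    simp only [ne_eq, mul_eq_zero, not_or] at this ⊢
    refine ⟨?_, this.2⟩
    fin_cases j
    exacts [this.1.1.1, this.1.1.2, this.1.2]

theorem isGood_MTilde :
    IsGood k ((ambientSpace k K).induced (Subtype.val : MTilde K → _)) :=
  (isGood_ambientSpace k K).induced _

theorem hom_cycleCoord :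
    Hom ((ambientSpace k K).induced (Subtype.val : MTilde K → _))
      (affineSpace k K (Fin 3)) fun m => cycleCoord m.1.2 := by
  have h : Hom ((ambientSpace k K).induced (Subtype.val : MTilde K → _))
      ((ambientSpace k K).induced (Subtype.val : crossRatioDomain K → _))
      fun m => ⟨m.1, m.2.1.ne (by decide), m.2.1.ne (by decide), m.2.1.ne (by decide),
        m.2.1.ne (by decide)⟩ :=
    Hom.into_induced (isGood_MTilde k K) (hom_induced _ _)
  exact (hom_cycleCoord_crossRatioDomain k K).comp h

theorem isGood_moduliSpace : IsGood k (moduliSpace k K) := (isGood_MTilde k K).quotient _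

theorem hom_moduliEquiv [CharZero K] :
    Hom (moduliSpace k K) ((projSpace k K 4).induced Subtype.val) (moduliEquiv K) := by
  refine Hom.into_induced (isGood_moduliSpace k K) (Hom.of_comp_quotient ?_)
  exact Hom.into_projSpace (isGood_MTilde k K) (f := fun m => phi (cycleCoord m.1.2))
    (fun m => phi_ne_zero (Moduli.mk m).exists_eq_mk_normalPoint.1.mem_affineDomain)
    (regular_phi (isGood_MTilde k K) (hom_cycleCoord k K).regular_coord)

variable {k K}

theorem regular_endoCoef {X : Type*} {A : FunSpace K X} (hA : IsGood k A) {t : X → Fin 3 → K}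
    (ht : ∀ i, A.regular Set.univ fun x => t x i) (i : Fin 6) :
    A.regular Set.univ fun x => endoCoef (t x) i := by
  have h1 := hA.regular_one Set.univ
  have hXZ := hA.add (hA.sub (hA.sub (ht 0) (ht 1)) (ht 2)) (hA.mul (ht 1) (ht 2))
  have hs := hA.add (hA.sub (ht 0) h1) (ht 2)
  have hC := hA.sub (hA.mul (ht 0) (hA.add (hA.sub (hA.mul (ht 0) (ht 1)) (ht 0)) (ht 2)))
    (hA.mul (ht 1) hs)
  have hD := hA.sub (hA.mul (hA.sub h1 (ht 2)) (hA.add (hA.sub (hA.mul (hA.pow (ht 0) 2) (ht 1))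
    (hA.pow (ht 0) 2)) (hA.mul (ht 0) (ht 2)))) (hA.mul (hA.sub (ht 0) (ht 2)) hs)
  fin_cases i
  · exact hA.mul (ht 0) hXZ
  · exact hA.mul (ht 0) (hA.sub hC (hA.mul (ht 2) hXZ))
  · exact hA.neg (hA.mul (hA.mul (ht 0) (ht 2)) hC)
  · exact hA.mul (ht 0) hXZ
  · exact hD
  · exact hA.regular_zero _

theorem regular_normalVec {X : Type*} {A : FunSpace K X} (hA : IsGood k A) {t : X → Fin 3 → K}
    (ht : ∀ i, A.regular Set.univ fun x => t x i) (i : Fin 6) (j : Fin 2) :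
    A.regular Set.univ fun x => normalVec (t x) i j := by
  have h0 := hA.regular_zero Set.univ
  have h1 := hA.regular_one Set.univ
  fin_cases i <;> fin_cases j
  exacts [h0, h1, h1, h0, h1, h1, ht 0, h1, ht 1, h1, ht 2, h1]

variable (k K)

/-- The coefficients and points of the normal form are polynomials in the coordinates of `psi`. They
give a regular lift to the product of cones, hence a regular section of the quotient by `PGL₂`. -/
theorem hom_moduliEquiv_symm [CharZero K] :
    Hom ((projSpace k K 4).induced Subtype.val) (moduliSpace k K) (moduliEquiv K).symm := by
  have hA := (isGood_projSpace k (K := K) 4).induced (Subtype.val : openPart K → _)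
  have hψ : Hom ((projSpace k K 4).induced (Subtype.val : openPart K → _))
      (affineSpace k K (Fin 3)) fun p => psi p.1.rep :=
    hom_psi.comp (Hom.into_induced (i := (Subtype.val : projDomain K → _))
      (f := fun p : openPart K => ⟨p.1, openPart_subset_projDomain p.2⟩) hA (hom_induced _ _))
  let s (p : openPart K) : AmbientCone K :=
    (⟨endoCoef (psi p.1.rep), fun h0 => mul_ne_zero (psi_rep_of_mem_openPart p.2).1.x0
      (psi_rep_of_mem_openPart p.2).1.hXZ (congrFun h0 0)⟩,
      fun i => ⟨normalVec (psi p.1.rep) i, normalVec_ne_zero _ i⟩)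
  have hs : Hom ((projSpace k K 4).induced (Subtype.val : openPart K → _))
      (ambientConeSpace k K) s := by
    refine Hom.into_induced hA (Hom.into_affineSpace hA ?_)
    rintro (i | ⟨i, j⟩)
    · exact regular_endoCoef hA hψ.regular_coord i
    · exact regular_normalVec hA hψ.regular_coord i j
  have hs' : Hom ((projSpace k K 4).induced (Subtype.val : openPart K → _))
      ((ambientSpace k K).induced (Subtype.val : MTilde K → _))
      fun p => normalPoint (psi_rep_of_mem_openPart p.2).1 (psi_rep_of_mem_openPart p.2).2 :=
    Hom.into_induced hA ((hom_quotient (ambientConeSpace k K) ambientProj).comp hs)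
  exact (hom_quotient _ Moduli.mk).comp hs'

theorem moduliEquiv_isIso [CharZero K] :
    IsIso (moduliSpace k K) ((projSpace k K 4).induced Subtype.val) (moduliEquiv K) :=
  isIso_of_hom (hom_moduliEquiv k K) (hom_moduliEquiv_symm k K)

/-- The boundary polynomial has coefficients in `k`, so the open part is open already in the Zariski
`k`-topology. -/
theorem isOpen_openPart :
    IsOpen[((projSpace k K 4).induced (Subtype.val : S6 K → _)).top]
      (Subtype.val ⁻¹' openPart K) := by
  refine ⟨{p | IsGeneric p.rep}, ?_, ?_⟩
  · refine ⟨_, isOpen_aeval_ne_zero (boundaryPoly k), ?_⟩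
    ext v
    have : MvPolynomial.aeval v.1 (boundaryPoly k) =
        MvPolynomial.eval v.1 (boundaryPoly K) := by simp [boundaryPoly]
    simp only [Set.mem_preimage, Set.mem_ofPred_eq, this, ne_eq, eval_boundaryPoly_eq_zero_iff,
      not_not]
    exact (isGeneric_rep_mk v.2).symm
  · ext p
    exact ⟨fun h => ⟨p.2, h⟩, fun h => h.2⟩

theorem S6_diff_openPart : S6 K \ openPart K = S6 K ∩ projZeros (boundaryPoly K) := by
  ext p
  refine and_congr_right fun hp => ?_
  change _ ↔ MvPolynomial.eval _ _ = 0
  rw [eval_boundaryPoly_eq_zero_iff]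
  exact not_congr (and_iff_right hp)

end ModuliIso

end M26

end

/-! ### The main theorem -/

open M26
theorem proposition2 (k : Type*) (K : Type*) [Field k] [CharZero k]
    [Field K] [IsAlgClosed K] [Algebra k K] :
    -- the surface is an irreducible quintic
    ((quintic K).IsHomogeneous 5 ∧ Irreducible (quintic K)) ∧
    -- the rational map `φ` is birational with inverse `ψ`
    (∃ e : affineDomain K ≃ projDomain K,
      FunSpace.IsIso ((affineSpace k K (Fin 3)).induced Subtype.val)
        ((projSpace k K 4).induced Subtype.val) e ∧
      (∀ t : affineDomain K, ∃ h : phi t.1 ≠ 0, (e t).1 = Projectivization.mk K (phi t.1) h) ∧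
      ∀ p : projDomain K, (e.symm p).1 = psi p.1.rep) ∧
    -- every class has a unique normal form, which embeds the moduli space into affine 3-space
    (∀ c : Moduli K, ∃! t : Fin 3 → K, ∃ m : MTilde K, m.1.2 = normalCycle t ∧ Moduli.mk m = c) ∧
    ∃ (U : Set (ℙ K (Fin 4 → K))) (Φ : Moduli K ≃ U),
      -- `Φ` is an isomorphism to an open subset of the quintic, given by `φ` on normal forms
      U ⊆ S6 K ∧
      IsOpen[((projSpace k K 4).induced (Subtype.val : S6 K → _)).top] (Subtype.val ⁻¹' U) ∧
      FunSpace.IsIso (moduliSpace k K) ((projSpace k K 4).induced Subtype.val) Φ ∧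
      (∀ (m : MTilde K) (t : Fin 3 → K), m.1.2 = normalCycle t →
        ∃ h : phi t ≠ 0, (Φ (Moduli.mk m)).1 = Projectivization.mk K (phi t) h) ∧
      -- the action of the rotation of the cycle
      (∀ c : Moduli K, (Φ (sigma6 c)).1 = tau (Φ c).1) ∧
      -- the complement is the union of nine lines and fourteen conics
      S6 K \ U = (⋃ i, lineCurve K i) ∪ ⋃ i, conicCurve K i ∧
      (∀ i, IsLine (lineCurve K i)) ∧
      (∀ i, IsConic (conicCurve K i)) ∧
      Function.Injective (Sum.elim (lineCurve K) (conicCurve K)) ∧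
      -- it is cut out by a hypersurface of positive degree
      ((boundaryPoly K).IsHomogeneous 14 ∧ boundaryPoly K ≠ 0 ∧
        S6 K \ U = S6 K ∩ projZeros (boundaryPoly K)) ∧
      -- the open subset in coordinates
      U = {p ∈ S6 K | quadForm p.rep ≠ 0 ∧ Function.Injective fun i => p.rep i ^ 2} := by
  have : CharZero K := charZero_of_injective_algebraMap (algebraMap k K).injective
  exact ⟨⟨quintic_isHomogeneous K, quintic_irreducible K⟩,
    ⟨phiEquiv K, phiEquiv_isIso k K, fun t => ⟨phi_ne_zero t.2, rfl⟩, fun _ => rfl⟩,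
    Moduli.existsUnique_normal,
    openPart K, moduliEquiv K, fun _ hp => hp.1, isOpen_openPart k K, moduliEquiv_isIso k K,
    moduliEquiv_mk, moduliEquiv_sigma6, (S6_diff_openPart K).trans S6_inter_boundary,
    isLine_lineCurve, isConic_conicCurve, curves_injective,
    ⟨boundaryPoly_isHomogeneous K, boundaryPoly_ne_zero K, S6_diff_openPart K⟩, rfl⟩
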